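/- For real \(x>0\) and \(z\in\mathbb R\) put \(r=(z^2+x^{2/3})^{1/2}\) and \(t=z\,x^{-1/3}\). Let \(k\in\mathbb Z\), \(\lambda=\tfrac12+3k\), and define, for \(t\in\mathbb R\), \[ \Lambda_k(t)=2\cdot 9^{\frac16+k}\,(1+t^2)^{-\lambda/2}\,\operatorname{Re}\Bigl\{e^{i\pi/3}\,U\bigl(-\tfrac{\lambda}{3},\tfrac23,-\tfrac{t^3}{9}\bigr)\Bigr\}, \] where \(U\) is the principal branch of Tricomi's confluent hypergeometric function, that is, for \(b\notin\mathbb Z\), \[ U(a,b,\zeta)=\frac{\Gamma(1-b)}{\Gamma(a-b+1)}M(a,b,\zeta)+\frac{\Gamma(b-1)}{\Gamma(a)}\zeta^{1-b}M(a-b+1,2-b,\zeta),\qquad M(a,b,\zeta)=\sum_{n\ge0}\frac{(a)_n}{(b)_n}\frac{\zeta^n}{n!}, \] with \((a)_n\) the rising factorial and \(\zeta^{1-b}\) the principal power, \(\arg\zeta\in(-\pi,\pi]\). Then \(\Lambda_k\in C^\infty(\mathbb R;\mathbb R)\) is bounded, \(\Lambda_k(t)\to1\) as \(t\to-\infty\),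 and \(\Lambda_k(t)\to0\) as \(t\to+\infty\). Moreover, the function \(v_k=r^{\frac12+3k}\Lambda_k(t)\) for \(x>0\), extended to the line \(x=0\) by \(v_k(0,z)=|z|^{\frac12+3k}\) for \(z<0\) and \(v_k(0,z)=0\) for \(z>0\) (the values \(\Lambda_k(\mp\infty)\)), is a classical solution of \[ z\,\partial_xu-\partial_{zz}u=0\quad(x\ge0,\ z\in\mathbb R,\ (x,z)\ne(0,0)),\qquad u(0,z)=0\quad(z>0). \] Here classical means: \(u\) is continuous on \(([0,\infty)\times\mathbb R)\setminus\{(0,0)\}\) and \(C^2\) on \(\{x>0\}\), the derivatives \(\partial_xu\), \(\partial_zu\), \(\partial_{zz}u\) exist at every point of \(([0,\infty)\times\mathbb R)\setminus\{(0,0)\}\) (with \(\partial_x\) one-sided at \(x=0\)), and the equation holds at each of these points. -/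

import Mathlib

open Filter Topology Set
open scoped ContDiff Real

noncomputable section

/-- Kummer's confluent hypergeometric function of the first kind,
`M(a,b,ζ) = ∑ (a)ₙ / (b)ₙ * ζⁿ / n!`, with rising factorials
(meaningful when `b` is not a nonpositive integer). -/
def kummerM (a b ζ : ℂ) : ℂ :=
  ∑' n : ℕ, (ascPochhammer ℂ n).eval a / (ascPochhammer ℂ n).eval b * (ζ ^ n / (n.factorial : ℂ))

/-- The combination of Kummer functions which defines Tricomi's function when `b ∉ ℤ`.
The power `ζ ^ (1 - b)` is the principal one (`arg ζ ∈ (-π, π]`), and `1 / Γ` vanishes at the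
poles of `Γ`. -/
def tricomiCombination (a b ζ : ℂ) : ℂ :=
  Complex.Gamma (1 - b) / Complex.Gamma (a - b + 1) * kummerM a b ζ
    + Complex.Gamma (b - 1) / Complex.Gamma a * ζ ^ (1 - b) * kummerM (a - b + 1) (2 - b) ζ

open Classical in
/-- Tricomi's confluent hypergeometric function of the second kind `U(a,b,ζ)`, principal branch.
For integer `b` it is defined by the usual limit in the second parameter. -/
def tricomiU (a b ζ : ℂ) : ℂ :=
  if ∃ n : ℤ, b = n then limUnder (𝓝[≠] b) (fun b' => tricomiCombination a b' ζ)
  else tricomiCombination a b ζ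

/-- The radial-like variable `r = (z² + x^{2/3})^{1/2}`, for `x ≥ 0`. -/
def radialVar (x z : ℝ) : ℝ := (z ^ 2 + x ^ (2 / 3 : ℝ)) ^ (1 / 2 : ℝ)

/-- The angular-like variable `t = z x^{-1/3}`, for `x > 0`. -/
def angularVar (x z : ℝ) : ℝ := z * x ^ (-(1 / 3) : ℝ)

/-- The homogeneity exponent `λ = 1/2 + 3k`. -/
def singExponent (k : ℤ) : ℝ := 1 / 2 + 3 * (k : ℝ)

/-- The angular profile
`Λ_k(t) = 2 · 9^{1/6+k} (1+t²)^{-λ/2} Re (e^{iπ/3} U(-λ/3, 2/3, -t³/9))`, `λ = 1/2 + 3k`. -/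
def angularProfile (k : ℤ) (t : ℝ) : ℝ :=
  2 * (9 : ℝ) ^ (1 / 6 + (k : ℝ)) * (1 + t ^ 2) ^ (-(singExponent k) / 2) *
    (Complex.exp (Complex.I * (π / 3 : ℝ)) *
      tricomiU ((-(singExponent k) / 3 : ℝ) : ℂ) (2 / 3) ((-t ^ 3 / 9 : ℝ) : ℂ)).re

/-- `v_k = r^{1/2+3k} Λ_k(t)` for `x > 0`. On the line `x = 0` the variable `t` equals `-∞` for
`z < 0` and `+∞` for `z > 0`, and the factor `Λ_k(t)` is replaced by `1` and `0` respectively;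
the value at the origin is irrelevant. -/
def singularSolution (k : ℤ) (x z : ℝ) : ℝ :=
  if 0 < x then radialVar x z ^ singExponent k * angularProfile k (angularVar x z)
  else if z < 0 then radialVar x z ^ singExponent k
  else 0

/-- The closed half-plane `x ≥ 0` without the origin. -/
def puncturedHalfPlane : Set (ℝ × ℝ) := {p | 0 ≤ p.1 ∧ p ≠ (0, 0)}

/-- `u` is a classical solution, away from the origin, of `z u_x - u_zz = 0` for `x ≥ 0`,
with `u(0,z) = 0` for `z > 0`. On the line `x = 0` the `x`-derivative is the one-sided one. -/
structure IsHalfPlaneSolution (u : ℝ → ℝ → ℝ) : Prop where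
  continuousOn : ContinuousOn (fun p : ℝ × ℝ => u p.1 p.2) puncturedHalfPlane
  contDiffOn : ContDiffOn ℝ 2 (fun p : ℝ × ℝ => u p.1 p.2) {p | 0 < p.1}
  differentiable_x : ∀ x z : ℝ, (x, z) ∈ puncturedHalfPlane →
    DifferentiableWithinAt ℝ (fun s => u s z) (Ici 0) x
  differentiable_z : ∀ x z : ℝ, (x, z) ∈ puncturedHalfPlane →
    DifferentiableAt ℝ (fun y => u x y) z
  differentiable_zz : ∀ x z : ℝ, (x, z) ∈ puncturedHalfPlane →
    DifferentiableAt ℝ (deriv (fun y => u x y)) z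
  equation : ∀ x z : ℝ, (x, z) ∈ puncturedHalfPlane →
    z * derivWithin (fun s => u s z) (Ici 0) x - deriv (deriv (fun y => u x y)) z = 0
  boundary : ∀ z : ℝ, 0 < z → u 0 z = 0

end

noncomputable section

open MeasureTheory Asymptotics

/-! Put a = -λ/3, b = 2/3. The phase e^{iπ/3} is what makes the profile smooth at t = 0. For t < 0
the power ζ^{1/3} of ζ = -t³/9 is real, and for t > 0 it carries a further e^{iπ/3}. Since Re
e^{iπ/3} = 1/2 and Re e^{2iπ/3} = -1/2, the real part is half of one entire function f(t), a
combination of M(a,2/3,-t³/9) and t·M(a+1/3,4/3,-t³/9) (`re_exp_mul_tricomiU`). For x > 0 the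
factors r^λ and (1+t²)^{-λ/2} cancel, leaving v = 9^{λ/3} x^{λ/3} f(z x^{-1/3}), and the PDE becomes
f'' + (t²/3) f' + a t f = 0, which is Kummer's equation (`hasDerivAt_entireProfileDeriv`).

The work is at x = 0, where t = ±∞. With q = 9x/|z|³ = 1/s, s = |t|³/9, v is |z|^λ times a function
of q, and one needs its value and one-sided derivative at q = 0. For z < 0 this function is s^a
U(a,2/3,s) = 1 - a(a+1/3)/s + O(s⁻²), and 9a(a+1/3) = λ(λ-1) is exactly what the equation asks of
|z|^λ. For z > 0, Kummer's transformation and the reflection formula turn f into a multiple of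
e^{-s} U(2/3-a,2/3,s), exponentially small. This requires sin π(a+1/3) = -sin πa, the condition met
by λ = 1/2 + 3k.

The expansion of U is proved for a > 0 from the Laplace integral of e^{-sτ}τ^{a-1}(1+τ)^{b-a-1},
identified with Γ(a)U through uniqueness for Kummer's equation with data at 0+
(`IsKummerSolution.eq_kummerReal`). The recurrence in a carries it to all real a
(`isBigO_tricomiReal`). Λ_k is v restricted to the curve r = 1, so its limits at ±∞ follow from
continuity of v at (0,±1). -/

/-! ### Kummer's series on the real line -/

/-- Taylor coefficients of `M(a,b,·)`. -/
def kummerCoeff (a b : ℝ) (n : ℕ) : ℝ :=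
  (ascPochhammer ℝ n).eval a / (ascPochhammer ℝ n).eval b / n.factorial

/-- Kummer's function `M(a,b,s)` for real arguments. -/
def kummerReal (a b s : ℝ) : ℝ := ∑' n : ℕ, kummerCoeff a b n * s ^ n

lemma ascPochhammer_eval_succ_left (a : ℝ) (n : ℕ) :
    (ascPochhammer ℝ (n + 1)).eval a = a * (ascPochhammer ℝ n).eval (a + 1) := by
  simp [ascPochhammer_succ_left]

lemma kummerCoeff_zero (a b : ℝ) : kummerCoeff a b 0 = 1 := by simp [kummerCoeff]

lemma kummerCoeff_succ {b : ℝ} (hb : 0 < b) (a : ℝ) (n : ℕ) :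
    kummerCoeff a b (n + 1) = kummerCoeff a b n * ((a + n) / ((b + n) * (n + 1))) := by
  have h := (ascPochhammer_pos n b hb).ne'
  have h2 : b + n ≠ 0 := by positivity
  simp only [kummerCoeff, ascPochhammer_succ_eval, Nat.factorial_succ]
  push_cast
  field_simp

lemma succ_mul_kummerCoeff_succ {b : ℝ} (hb : 0 < b) (a : ℝ) (n : ℕ) :
    (n + 1) * kummerCoeff a b (n + 1) = a / b * kummerCoeff (a + 1) (b + 1) n := by
  have h := (ascPochhammer_pos n (b + 1) (by linarith)).ne'
  simp only [kummerCoeff, ascPochhammer_eval_succ_left, Nat.factorial_succ]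
  push_cast
  field_simp

lemma summable_kummer {b : ℝ} (hb : 0 < b) (a s : ℝ) :
    Summable fun n : ℕ => kummerCoeff a b n * s ^ n := by
  refine summable_of_ratio_norm_eventually_le (r := 1 / 2) (by norm_num) ?_
  filter_upwards [eventually_ge_atTop 1, eventually_ge_atTop ⌈2 * (|s| * (|a| + 1))⌉₊]
    with n h1 h2
  have h1' : (1 : ℝ) ≤ n := by exact_mod_cast h1
  have h2' : 2 * (|s| * (|a| + 1)) ≤ n := Nat.ceil_le.1 h2
  rw [kummerCoeff_succ hb, pow_succ]
  have hbn : 0 < (b + n) * ((n : ℝ) + 1) := by positivity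
  have key : |(a + n) / ((b + n) * (n + 1))| * |s| ≤ 1 / 2 := by
    rw [abs_div, abs_of_pos hbn, div_mul_eq_mul_div, div_le_iff₀ hbn]
    have h3 : |a + n| ≤ (|a| + 1) * (b + n) := by
      have := abs_add_le a n
      rw [abs_of_nonneg (by positivity : (0 : ℝ) ≤ n)] at this
      nlinarith [abs_nonneg a]
    calc |a + n| * |s| ≤ (|a| + 1) * (b + n) * |s| := by gcongr
      _ = (|s| * (|a| + 1)) * (b + n) := by ring
      _ ≤ ((n + 1) / 2) * (b + n) := by gcongr; linarith
      _ = _ := by ring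
  simp only [norm_mul, Real.norm_eq_abs]
  calc _ = |(a + n) / ((b + n) * (n + 1))| * |s| * (|kummerCoeff a b n| * |s ^ n|) := by ring
    _ ≤ _ := by gcongr

lemma hasDerivAt_tsum_mul_pow {c : ℕ → ℝ} (hc : ∀ s : ℝ, Summable fun n => c n * s ^ n)
    (s : ℝ) :
    HasDerivAt (fun s => ∑' n, c n * s ^ n) (∑' n : ℕ, (n + 1) * c (n + 1) * s ^ n) s := by
  set R : ℝ := |s| + 1 with hR
  have hR1 : 1 ≤ R := by simp [hR]
  have hu : Summable fun n : ℕ => (n : ℝ) * |c n| * R ^ (n - 1) := by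
    have h := (hc (2 * R)).norm
    refine h.of_nonneg_of_le
      (fun n => mul_nonneg (by positivity) (pow_nonneg (by linarith) _)) fun n => ?_
    -- The factor n from differentiation is absorbed by doubling the radius: the differentiated
    -- series on the ball of radius R is dominated by the original one at 2R.
    have h2 : (n : ℝ) ≤ 2 ^ n := by exact_mod_cast Nat.lt_two_pow_self.le
    have hR0 : 0 ≤ 2 * R := by linarith
    rw [norm_mul, norm_pow, Real.norm_eq_abs, Real.norm_eq_abs, abs_of_nonneg hR0,
      mul_pow, mul_comm (n : ℝ), mul_assoc]
    have := pow_le_pow_right₀ hR1 (Nat.sub_le n 1)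
    gcongr
  have h := hasDerivAt_tsum_of_isPreconnected (t := Metric.ball (0 : ℝ) R) (y₀ := s) (y := s)
    (g := fun n s => c n * s ^ n) (g' := fun n s => c n * (n * s ^ (n - 1))) hu Metric.isOpen_ball
    (convex_ball _ _).isPreconnected
    (fun n y _ => (hasDerivAt_pow n y).const_mul _) (fun n y hy => ?_) (by simp [hR]) (hc s)
    (by simp [hR])
  · have e : ∑' n : ℕ, (n + 1) * c (n + 1) * s ^ n = ∑' n : ℕ, c n * (n * s ^ (n - 1)) := by
      rw [Summable.tsum_eq_zero_add (f := fun n : ℕ => c n * (n * s ^ (n - 1)))]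
      · simp only [Nat.cast_zero, zero_mul, mul_zero, zero_add, Nat.add_sub_cancel]
        exact tsum_congr fun n => by push_cast; ring
      · refine hu.of_norm_bounded fun n => ?_
        rw [norm_mul, norm_mul, norm_pow, Real.norm_eq_abs, Real.norm_natCast, ← mul_assoc,
          mul_comm |c n|]
        gcongr
        simp [hR]
    rw [e]
    exact h
  · have : |y| < R := by simpa using hy
    rw [norm_mul, norm_mul, norm_pow, Real.norm_eq_abs, Real.norm_natCast, ← mul_assoc,
        mul_comm |c n|]
    gcongr
    exact this.le

lemma hasDerivAt_kummerReal {b : ℝ} (hb : 0 < b) (a s : ℝ) :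
    HasDerivAt (kummerReal a b) (a / b * kummerReal (a + 1) (b + 1) s) s := by
  have h := hasDerivAt_tsum_mul_pow (summable_kummer hb a) s
  simp only [succ_mul_kummerCoeff_succ hb, mul_assoc, tsum_mul_left] at h
  exact h

lemma contDiff_kummerReal {b : ℝ} (hb : 0 < b) (a : ℝ) : ContDiff ℝ ∞ (kummerReal a b) := by
  rw [contDiff_infty]
  intro n
  induction n generalizing a b with
  | zero =>
    exact contDiff_zero.2 (continuous_iff_continuousAt.2
      fun s => (hasDerivAt_kummerReal hb a s).continuousAt)
  | succ n ih =>
    push_cast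
    rw [contDiff_succ_iff_deriv]
    refine ⟨fun s => (hasDerivAt_kummerReal hb a s).differentiableAt, by simp, ?_⟩
    rw [funext fun s => (hasDerivAt_kummerReal hb a s).deriv]
    exact contDiff_const.mul (ih (by linarith) _)

lemma continuous_kummerReal {b : ℝ} (hb : 0 < b) (a : ℝ) : Continuous (kummerReal a b) :=
  (contDiff_kummerReal hb a).continuous

lemma kummerReal_eq_one_add {b : ℝ} (hb : 0 < b) (a s : ℝ) :
    kummerReal a b s = 1 + s * ∑' n : ℕ, kummerCoeff a b (n + 1) * s ^ n := by
  rw [kummerReal, (summable_kummer hb a s).tsum_eq_zero_add, ← tsum_mul_left]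
  simp only [kummerCoeff_zero, pow_zero, mul_one, pow_succ]
  congr 1
  exact tsum_congr fun n => by ring

lemma kummerReal_zero {b : ℝ} (hb : 0 < b) (a : ℝ) : kummerReal a b 0 = 1 := by
  simp [kummerReal_eq_one_add hb]

lemma summable_kummer_succ {b : ℝ} (hb : 0 < b) (a s : ℝ) :
    Summable fun n : ℕ => kummerCoeff a b (n + 1) * s ^ n := by
  have h := (summable_kummer (b := b + 1) (by linarith) (a + 1) s).norm.mul_left |a / b|
  refine h.of_norm_bounded fun n => ?_
  have h1 := succ_mul_kummerCoeff_succ hb a n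
  have h2 : kummerCoeff a b (n + 1) = a / b * kummerCoeff (a + 1) (b + 1) n / (n + 1) := by
    rw [← h1]; field_simp
  rw [h2, norm_mul, norm_div, norm_mul, norm_mul, ← mul_assoc, Real.norm_eq_abs (a / b)]
  gcongr
  refine div_le_self (by positivity) ?_
  rw [Real.norm_eq_abs, abs_of_nonneg (by positivity)]
  simp

/-- Kummer's differential equation. -/
lemma kummerReal_ode {b : ℝ} (hb : 0 < b) (a s : ℝ) :
    s * (a / b * ((a + 1) / (b + 1) * kummerReal (a + 1 + 1) (b + 1 + 1) s))
      + (b - s) * (a / b * kummerReal (a + 1) (b + 1) s) - a * kummerReal a b s = 0 := by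
  have hb1 : 0 < b + 1 := by linarith
  have hb2 : 0 < b + 1 + 1 := by linarith
  have e1 := kummerReal_eq_one_add hb a s
  have e2 := kummerReal_eq_one_add hb1 (a + 1) s
  have s0 := summable_kummer_succ hb a s
  have s1 := summable_kummer_succ hb1 (a + 1) s
  have s2 := summable_kummer hb2 (a + 1 + 1) s
  have s3 := summable_kummer hb1 (a + 1) s
  -- Writing M = 1 + s·(tail) cancels the constant terms and leaves a common factor s; the remaining
  -- identity holds coefficient by coefficient.
  have key : a / b * ((a + 1) / (b + 1) * kummerReal (a + 1 + 1) (b + 1 + 1) s)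
      + a * (∑' n : ℕ, kummerCoeff (a + 1) (b + 1) (n + 1) * s ^ n)
      - a / b * kummerReal (a + 1) (b + 1) s
      - a * (∑' n : ℕ, kummerCoeff a b (n + 1) * s ^ n) = 0 := by
    simp only [kummerReal]
    rw [← tsum_mul_left, ← tsum_mul_left, ← tsum_mul_left, ← tsum_mul_left, ← tsum_mul_left,
      ← ((s2.mul_left _).mul_left _).tsum_add (s1.mul_left _),
      ← (((s2.mul_left _).mul_left _).add (s1.mul_left _)).tsum_sub (s3.mul_left _),
      ← ((((s2.mul_left _).mul_left _).add (s1.mul_left _)).sub (s3.mul_left _)).tsum_sub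
        (s0.mul_left _)]
    convert tsum_zero with n
    have h1 := succ_mul_kummerCoeff_succ hb a n
    have h2 := succ_mul_kummerCoeff_succ hb1 (a + 1) n
    have h3 := kummerCoeff_succ hb1 (a + 1) n
    have h1' : kummerCoeff a b (n + 1) = a / b * kummerCoeff (a + 1) (b + 1) n / (n + 1) := by
      rw [← h1]; field_simp
    have hn : b + 1 + n ≠ 0 := by positivity
    calc _ = (a / b * ((a + 1) / (b + 1) * kummerCoeff (a + 1 + 1) (b + 1 + 1) n)
        + a * kummerCoeff (a + 1) (b + 1) (n + 1) - a / b * kummerCoeff (a + 1) (b + 1) n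
        - a * kummerCoeff a b (n + 1)) * s ^ n := by ring
      _ = 0 := by
        rw [← h2, h1', h3]
        field_simp
        ring
  rw [e1]
  have e2' : (b - s) * (a / b * kummerReal (a + 1) (b + 1) s)
      = a * kummerReal (a + 1) (b + 1) s - s * (a / b * kummerReal (a + 1) (b + 1) s) := by
    field_simp
  rw [e2']
  nth_rewrite 1 [e2]
  linear_combination s * key

/-- The three-term relation between `M(a-1,b,s)`, `M(a,b,s)` and `M(a+1,b,s)`. -/
lemma kummerReal_contiguous {b : ℝ} (hb : 0 < b) (a s : ℝ) :
    (b - a) * kummerReal (a - 1) b s + (2 * a - b + s) * kummerReal a b s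
      - a * kummerReal (a + 1) b s = 0 := by
  have e0 := kummerReal_eq_one_add hb (a - 1) s
  have e1 := kummerReal_eq_one_add hb a s
  have e2 := kummerReal_eq_one_add hb (a + 1) s
  have s0 := summable_kummer_succ hb (a - 1) s
  have s1 := summable_kummer_succ hb a s
  have s2 := summable_kummer_succ hb (a + 1) s
  have s3 := summable_kummer hb a s
  have key : (b - a) * (∑' n : ℕ, kummerCoeff (a - 1) b (n + 1) * s ^ n)
      + (2 * a - b) * (∑' n : ℕ, kummerCoeff a b (n + 1) * s ^ n)
      + kummerReal a b s - a * (∑' n : ℕ, kummerCoeff (a + 1) b (n + 1) * s ^ n) = 0 := by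
    simp only [kummerReal]
    rw [← tsum_mul_left, ← tsum_mul_left, ← tsum_mul_left,
      ← (s0.mul_left _).tsum_add (s1.mul_left _),
      ← ((s0.mul_left _).add (s1.mul_left _)).tsum_add s3,
      ← (((s0.mul_left _).add (s1.mul_left _)).add s3).tsum_sub (s2.mul_left _)]
    convert tsum_zero with n
    have hn : b + n ≠ 0 := by positivity
    have hP := (ascPochhammer_pos n b hb).ne'
    have f0 : (ascPochhammer ℝ (n + 1)).eval (a - 1) = (a - 1) * (ascPochhammer ℝ n).eval a := by
      rw [ascPochhammer_eval_succ_left]; simp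
    have f2 : a * (ascPochhammer ℝ (n + 1)).eval (a + 1)
        = (ascPochhammer ℝ n).eval a * (a + n) * (a + (n + 1)) := by
      rw [← ascPochhammer_eval_succ_left, ascPochhammer_succ_eval, ascPochhammer_succ_eval]
      push_cast; ring
    calc _ = ((b - a) * kummerCoeff (a - 1) b (n + 1) + (2 * a - b) * kummerCoeff a b (n + 1)
        + kummerCoeff a b n - a * kummerCoeff (a + 1) b (n + 1)) * s ^ n := by ring
      _ = ((b - a) * ((a - 1) * (ascPochhammer ℝ n).eval a)
          + (2 * a - b) * ((ascPochhammer ℝ n).eval a * (a + n))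
          + (ascPochhammer ℝ n).eval a * (b + n) * (n + 1)
          - a * (ascPochhammer ℝ (n + 1)).eval (a + 1))
          / ((ascPochhammer ℝ n).eval b * (b + n)) / ((n + 1) * n.factorial) * s ^ n := by
        have fa : (ascPochhammer ℝ (n + 1)).eval a = (ascPochhammer ℝ n).eval a * (a + n) :=
          ascPochhammer_succ_eval ..
        have fb : (ascPochhammer ℝ (n + 1)).eval b = (ascPochhammer ℝ n).eval b * (b + n) :=
          ascPochhammer_succ_eval ..
        simp only [kummerCoeff, f0, fa, fb, Nat.factorial_succ]
        push_cast
        field_simp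
      _ = 0 := by
        rw [f2]
        ring
  linear_combination s * key + (b - a) * e0 + (2 * a - b) * e1 - a * e2

lemma ascPochhammer_eval_ofReal (a : ℝ) (n : ℕ) :
    (ascPochhammer ℂ n).eval (a : ℂ) = ((ascPochhammer ℝ n).eval a : ℝ) := by
  rw [← ascPochhammer_map (algebraMap ℝ ℂ), Polynomial.eval_map]
  exact Polynomial.eval₂_at_apply (algebraMap ℝ ℂ) a

lemma kummerM_ofReal (a b s : ℝ) : kummerM a b s = (kummerReal a b s : ℝ) := by
  rw [kummerM, kummerReal, Complex.ofReal_tsum]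
  refine tsum_congr fun n => ?_
  rw [kummerCoeff, ascPochhammer_eval_ofReal, ascPochhammer_eval_ofReal]
  push_cast
  ring

/-! ### Kummer's equation on (0,∞): Wronskians, uniqueness, Kummer's transformation -/

/-- `f` solves `s f'' + (b - σ s) f' - σ a f = 0` on `(0,∞)`, which for `σ = ±1` is Kummer's
equation in the variable `σ s`, and has the data `f → f₀`, `s ^ b f' → f₁` at `0+`. -/
structure IsKummerSolution (σ a b : ℝ) (f f' : ℝ → ℝ) (f₀ f₁ : ℝ) : Prop where
  hasDerivAt : ∀ s, 0 < s → HasDerivAt f (f' s) s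
  hasDerivAt' : ∀ s, 0 < s → HasDerivAt f' (((σ * s - b) * f' s + σ * a * f s) / s) s
  tendsto : Tendsto f (𝓝[>] 0) (𝓝 f₀)
  tendsto' : Tendsto (fun s => s ^ b * f' s) (𝓝[>] 0) (𝓝 f₁)

/-- Abel's identity: s^b e^{-σs} is the integrating factor, so the weighted Wronskian is constant
and can be read off from the data at 0+. -/
lemma IsKummerSolution.wronskian {σ a b : ℝ} {f f' g g' : ℝ → ℝ} {f₀ f₁ g₀ g₁ : ℝ}
    (hf : IsKummerSolution σ a b f f' f₀ f₁) (hg : IsKummerSolution σ a b g g' g₀ g₁)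
    {s : ℝ} (hs : 0 < s) :
    s ^ b * Real.exp (-(σ * s)) * (f s * g' s - f' s * g s) = f₀ * g₁ - f₁ * g₀ := by
  set W : ℝ → ℝ := fun s => s ^ b * Real.exp (-(σ * s)) * (f s * g' s - f' s * g s) with hW
  have hd : ∀ x, 0 < x → HasDerivAt W 0 x := by
    intro x hx
    have h1 := Real.hasDerivAt_rpow_const (p := b) (Or.inl hx.ne')
    have h2 := ((hasDerivAt_id x).const_mul σ).neg.exp
    have h3 := (hf.hasDerivAt x hx).mul (hg.hasDerivAt' x hx)
    have h4 := (hf.hasDerivAt' x hx).mul (hg.hasDerivAt x hx)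
    refine ((h1.mul h2).mul (h3.sub h4)).congr_deriv ?_
    have e : x ^ (b - 1) = x ^ b / x := by rw [Real.rpow_sub hx, Real.rpow_one]
    simp only [id, Pi.mul_apply, Pi.sub_apply, Pi.neg_apply, e]
    field_simp
    ring
  have hconst : ∀ x ∈ Ioi (0 : ℝ), W x = W s := fun x hx =>
    isOpen_Ioi.is_const_of_deriv_eq_zero (convex_Ioi 0).isPreconnected
      (fun y hy => (hd y hy).differentiableAt.differentiableWithinAt)
      (fun y hy => (hd y hy).deriv) hx hs
  have hlim : Tendsto W (𝓝[>] 0) (𝓝 (f₀ * g₁ - f₁ * g₀)) := by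
    have he : Tendsto (fun x : ℝ => Real.exp (-(σ * x))) (𝓝[>] 0) (𝓝 1) := by
      have : Continuous fun x : ℝ => Real.exp (-(σ * x)) := by fun_prop
      simpa using (this.tendsto 0).mono_left nhdsWithin_le_nhds
    have := he.mul ((hf.tendsto.mul hg.tendsto').sub (hf.tendsto'.mul hg.tendsto))
    rw [one_mul] at this
    refine this.congr fun x => ?_
    simp only [hW]
    ring
  have hlim' : Tendsto W (𝓝[>] 0) (𝓝 (W s)) :=
    tendsto_const_nhds.congr' <| by
      filter_upwards [self_mem_nhdsWithin] with x hx using (hconst x hx).symm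
  exact tendsto_nhds_unique hlim' hlim

lemma hasDerivAt_kummerReal_comp_mul {b : ℝ} (hb : 0 < b) (σ a s : ℝ) :
    HasDerivAt (fun s => kummerReal a b (σ * s))
      (σ * (a / b * kummerReal (a + 1) (b + 1) (σ * s))) s := by
  have h := (hasDerivAt_kummerReal hb a (σ * s)).comp s ((hasDerivAt_id s).const_mul σ)
  refine h.congr_deriv ?_
  ring

lemma isKummerSolution_kummerReal {b : ℝ} (hb : 0 < b) (σ a : ℝ) :
    IsKummerSolution σ a b (fun s => kummerReal a b (σ * s))
      (fun s => σ * (a / b * kummerReal (a + 1) (b + 1) (σ * s))) 1 0 where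
  hasDerivAt s _ := hasDerivAt_kummerReal_comp_mul hb σ a s
  hasDerivAt' s hs := by
    refine (((hasDerivAt_kummerReal_comp_mul (b := b + 1) (by linarith) σ (a + 1) s).const_mul
      (a / b)).const_mul σ).congr_deriv ?_
    rw [eq_div_iff hs.ne']
    linear_combination σ * kummerReal_ode hb a (σ * s)
  tendsto := by
    have := (((continuous_kummerReal hb a).comp (continuous_const_mul σ)).tendsto 0).mono_left
      (nhdsWithin_le_nhds (s := Ioi (0 : ℝ)))
    simpa [Function.comp_def, kummerReal_zero hb] using this
  tendsto' := by
    have h1 := continuous_kummerReal (b := b + 1) (by linarith) (a + 1)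
    have h2 : Continuous fun s : ℝ => s ^ b := Real.continuous_rpow_const hb.le
    have h3 : Continuous fun s : ℝ =>
        s ^ b * (σ * (a / b * kummerReal (a + 1) (b + 1) (σ * s))) := by fun_prop
    have := (h3.tendsto 0).mono_left (nhdsWithin_le_nhds (s := Ioi (0 : ℝ)))
    simpa [Real.zero_rpow hb.ne'] using this

/-- The solution with the other exponent 1-b at 0. Its data (0, 1-b) complement the data (1, 0) of
M, so the two span all solutions. -/
lemma isKummerSolution_rpow_mul_kummerReal {b : ℝ} (hb0 : 0 < b) (hb1 : b < 1) (σ a : ℝ) :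
    IsKummerSolution σ a b (fun s => s ^ (1 - b) * kummerReal (a - b + 1) (2 - b) (σ * s))
      (fun s => (1 - b) * s ^ (-b) * kummerReal (a - b + 1) (2 - b) (σ * s)
        + s ^ (1 - b) * (σ * ((a - b + 1) / (2 - b)
          * kummerReal (a - b + 1 + 1) (2 - b + 1) (σ * s))))
      0 (1 - b) where
  hasDerivAt s hs := by
    have h1 := Real.hasDerivAt_rpow_const (p := 1 - b) (Or.inl hs.ne')
    refine (h1.mul (hasDerivAt_kummerReal_comp_mul (b := 2 - b) (by linarith) σ
      (a - b + 1) s)).congr_deriv ?_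
    rw [show 1 - b - 1 = -b by ring]
  hasDerivAt' s hs := by
    have hb2 : 0 < 2 - b := by linarith
    have h1 := Real.hasDerivAt_rpow_const (p := 1 - b) (Or.inl hs.ne')
    have h2 := (Real.hasDerivAt_rpow_const (p := -b) (Or.inl hs.ne')).const_mul (1 - b)
    have h3 := hasDerivAt_kummerReal_comp_mul hb2 σ (a - b + 1) s
    have h4 := ((hasDerivAt_kummerReal_comp_mul (b := 2 - b + 1) (by linarith) σ
      (a - b + 1 + 1) s).const_mul ((a - b + 1) / (2 - b))).const_mul σ
    refine ((h2.mul h3).add (h1.mul h4)).congr_deriv ?_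
    have e1 : s ^ (1 - b) = s ^ (-b) * s := by
      rw [← Real.rpow_add_one hs.ne']; congr 1; ring
    have e2 : s ^ (-b - 1) = s ^ (-b) / s := by rw [Real.rpow_sub hs, Real.rpow_one]
    have e3 : s ^ (1 - b - 1) = s ^ (-b) := by congr 1; ring
    rw [eq_div_iff hs.ne', e2, e3, e1]
    have ode := kummerReal_ode hb2 (a - b + 1) (σ * s)
    generalize kummerReal (a - b + 1 + 1 + 1) (2 - b + 1 + 1) (σ * s) = N2 at *
    generalize kummerReal (a - b + 1 + 1) (2 - b + 1) (σ * s) = N1 at *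
    generalize kummerReal (a - b + 1) (2 - b) (σ * s) = N at *
    generalize (a - b + 1) / (2 - b) = c at *
    generalize (a - b + 1 + 1) / (2 - b + 1) = d at *
    have e4 : (1 - b) * (-b * (s ^ (-b) / s)) * s = (1 - b) * (-b * s ^ (-b)) := by
      field_simp
    linear_combination (σ * s ^ (-b) * s) * ode + N * e4
  tendsto := by
    have h1 := continuous_kummerReal (b := 2 - b) (by linarith) (a - b + 1)
    have h2 : Continuous fun s : ℝ => s ^ (1 - b) := Real.continuous_rpow_const (by linarith)
    have h3 : Continuous fun s : ℝ =>
        s ^ (1 - b) * kummerReal (a - b + 1) (2 - b) (σ * s) := by fun_prop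
    have := (h3.tendsto 0).mono_left (nhdsWithin_le_nhds (s := Ioi (0 : ℝ)))
    simpa [Real.zero_rpow (sub_pos.2 hb1).ne'] using this
  tendsto' := by
    have hb2 : 0 < 2 - b := by linarith
    have hb3 : 0 < 2 - b + 1 := by linarith
    have c0 := continuous_kummerReal hb2 (a - b + 1)
    have c1 := continuous_kummerReal hb3 (a - b + 1 + 1)
    have h : Continuous fun s : ℝ => (1 - b) * kummerReal (a - b + 1) (2 - b) (σ * s)
        + s * (σ * ((a - b + 1) / (2 - b)
          * kummerReal (a - b + 1 + 1) (2 - b + 1) (σ * s))) := by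
      fun_prop
    have := (h.tendsto 0).mono_left (nhdsWithin_le_nhds (s := Ioi (0 : ℝ)))
    simp only [mul_zero, kummerReal_zero hb2, mul_one, zero_mul, add_zero] at this
    refine this.congr' ?_
    filter_upwards [self_mem_nhdsWithin] with s (hs : 0 < s)
    have e1 : s ^ b * s ^ (-b) = 1 := by rw [← Real.rpow_add hs]; simp
    have e2 : s ^ b * s ^ (1 - b) = s := by rw [← Real.rpow_add hs]; simp
    linear_combination (-(1 - b) * kummerReal (a - b + 1) (2 - b) (σ * s)) * e1
      - (σ * ((a - b + 1) / (2 - b) * kummerReal (a - b + 1 + 1) (2 - b + 1) (σ * s))) * e2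

/-- A solution of Kummer's equation on `(0,∞)` is determined by its data at `0+`. -/
lemma IsKummerSolution.eq_kummerReal {σ a b : ℝ} (hb0 : 0 < b) (hb1 : b < 1) {f f' : ℝ → ℝ}
    {f₀ f₁ : ℝ} (hf : IsKummerSolution σ a b f f' f₀ f₁) {s : ℝ} (hs : 0 < s) :
    f s = f₀ * kummerReal a b (σ * s)
      + f₁ / (1 - b) * (s ^ (1 - b) * kummerReal (a - b + 1) (2 - b) (σ * s)) := by
  have h1 := isKummerSolution_kummerReal hb0 σ a
  have h2 := isKummerSolution_rpow_mul_kummerReal hb0 hb1 σ a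
  have w12 := h1.wronskian h2 hs
  have w2f := h2.wronskian hf hs
  have wf1 := hf.wronskian h1 hs
  have hb : 1 - b ≠ 0 := by linarith
  field_simp
  -- The cyclic identity f·W(f₁,f₂) + f₁·W(f₂,f) + f₂·W(f,f₁) = 0, with every weighted Wronskian
  -- replaced by its constant value.
  linear_combination (-f s) * w12 - kummerReal a b (σ * s) * w2f
    - (s ^ (1 - b) * kummerReal (a - b + 1) (2 - b) (σ * s)) * wf1

/-- Multiplication by e^{-σs} is a symmetry of the equation that reverses σ, sends a to b-a and
keeps the data at 0+. Combined with uniqueness it yields Kummer's transformation. -/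
lemma IsKummerSolution.exp_mul {σ a b : ℝ} (hb0 : 0 < b) {f f' : ℝ → ℝ} {f₀ f₁ : ℝ}
    (hf : IsKummerSolution σ a b f f' f₀ f₁) :
    IsKummerSolution (-σ) (b - a) b (fun s => Real.exp (-(σ * s)) * f s)
      (fun s => Real.exp (-(σ * s)) * (f' s - σ * f s)) f₀ f₁ := by
  have hexp : ∀ s : ℝ, HasDerivAt (fun s => Real.exp (-(σ * s)))
      (Real.exp (-(σ * s)) * -(σ * 1)) s := fun s => ((hasDerivAt_id s).const_mul σ).neg.exp
  have he : Tendsto (fun x : ℝ => Real.exp (-(σ * x))) (𝓝[>] 0) (𝓝 1) := by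
    have : Continuous fun x : ℝ => Real.exp (-(σ * x)) := by fun_prop
    simpa using (this.tendsto 0).mono_left nhdsWithin_le_nhds
  refine ⟨fun s hs => ?_, fun s hs => ?_, ?_, ?_⟩
  · refine ((hexp s).mul (hf.hasDerivAt s hs)).congr_deriv ?_
    ring
  · refine ((hexp s).mul ((hf.hasDerivAt' s hs).sub
      ((hf.hasDerivAt s hs).const_mul σ))).congr_deriv ?_
    simp only [Pi.sub_apply]
    field_simp
    ring
  · simpa using he.mul hf.tendsto
  · have h2 : Tendsto (fun s : ℝ => s ^ b) (𝓝[>] 0) (𝓝 0) := by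
      have := ((Real.continuous_rpow_const hb0.le).tendsto 0).mono_left
        (nhdsWithin_le_nhds (s := Ioi (0 : ℝ)))
      rwa [Real.zero_rpow hb0.ne'] at this
    have := he.mul (hf.tendsto'.sub ((h2.mul hf.tendsto).const_mul σ))
    simp only [zero_mul, mul_zero, sub_zero, one_mul] at this
    refine this.congr fun s => ?_
    ring

/-- Kummer's transformation for `M(a,b,-s)`. -/
lemma kummerReal_neg {b : ℝ} (hb0 : 0 < b) (hb1 : b < 1) (a : ℝ) {s : ℝ} (hs : 0 < s) :
    kummerReal a b (-s) = Real.exp (-s) * kummerReal (b - a) b s := by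
  have h := ((isKummerSolution_kummerReal hb0 1 (b - a)).exp_mul hb0).eq_kummerReal hb0 hb1 hs
  simpa using h.symm

/-- Kummer's transformation for `M(a-b+1,2-b,-s)`. -/
lemma kummerReal_two_sub_neg {b : ℝ} (hb0 : 0 < b) (hb1 : b < 1) (a : ℝ) {s : ℝ} (hs : 0 < s) :
    kummerReal (a - b + 1) (2 - b) (-s) = Real.exp (-s) * kummerReal (1 - a) (2 - b) s := by
  have h := ((isKummerSolution_rpow_mul_kummerReal hb0 hb1 1 (b - a)).exp_mul hb0).eq_kummerReal
    hb0 hb1 hs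
  have hb : 1 - b ≠ 0 := by linarith
  have hs' : s ^ (1 - b) ≠ 0 := (Real.rpow_pos_of_pos hs _).ne'
  rw [div_self hb, zero_mul, zero_add, one_mul, one_mul, neg_one_mul, sub_sub_cancel,
    mul_left_comm] at h
  rw [← mul_left_cancel₀ hs' h, show b - a - b + 1 = 1 - a by ring]

/-! ### The Laplace integral as a solution of Kummer's equation -/

/-- The integrand of the Laplace integral `∫₀^∞ e^{-sτ} τ^{α-1} (1+τ)^{-c} dτ`. -/
def laplaceKernel (α c s τ : ℝ) : ℝ := Real.exp (-(s * τ)) * τ ^ (α - 1) * (1 + τ) ^ (-c)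

/-- The Laplace integral `∫₀^∞ e^{-sτ} τ^{α-1} (1+τ)^{-c} dτ`. -/
def laplaceIntegral (α c s : ℝ) : ℝ := ∫ τ in Ioi (0 : ℝ), laplaceKernel α c s τ

lemma integrableOn_exp_mul_rpow {α s : ℝ} (hα : 0 < α) (hs : 0 < s) :
    IntegrableOn (fun τ : ℝ => Real.exp (-(s * τ)) * τ ^ (α - 1)) (Ioi 0) := by
  have h := integrableOn_rpow_mul_exp_neg_mul_rpow (s := α - 1) (p := 1) (b := s)
    (by linarith) one_pos hs
  simp only [Real.rpow_one] at h
  refine h.congr_fun (fun τ _ => ?_) measurableSet_Ioi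
  simp only [neg_mul]
  ring

lemma integral_exp_mul_rpow {α s : ℝ} (hα : 0 < α) (hs : 0 < s) :
    ∫ τ in Ioi (0 : ℝ), Real.exp (-(s * τ)) * τ ^ (α - 1) = s ^ (-α) * Real.Gamma α := by
  have h := Real.integral_rpow_mul_exp_neg_mul_Ioi hα hs
  rw [one_div, Real.inv_rpow hs.le, ← Real.rpow_neg hs.le] at h
  rw [← h]
  exact integral_congr_ae (ae_of_all _ fun τ => mul_comm _ _)

lemma measurable_laplaceKernel (α c s : ℝ) : Measurable (laplaceKernel α c s) := by
  unfold laplaceKernel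
  fun_prop

lemma one_add_rpow_neg_le_one {c τ : ℝ} (hc : 0 ≤ c) (hτ : 0 ≤ τ) : (1 + τ) ^ (-c) ≤ 1 :=
  Real.rpow_le_one_of_one_le_of_nonpos (by linarith) (by linarith)

lemma laplaceKernel_nonneg {α c s τ : ℝ} (hτ : 0 < τ) : 0 ≤ laplaceKernel α c s τ := by
  unfold laplaceKernel
  positivity

lemma laplaceKernel_le {α c s τ : ℝ} (hc : 0 ≤ c) (hτ : 0 < τ) :
    laplaceKernel α c s τ ≤ Real.exp (-(s * τ)) * τ ^ (α - 1) := by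
  unfold laplaceKernel
  exact mul_le_of_le_one_right (by positivity) (one_add_rpow_neg_le_one hc hτ.le)

lemma integrableOn_laplaceKernel {α c s : ℝ} (hα : 0 < α) (hc : 0 ≤ c) (hs : 0 < s) :
    IntegrableOn (laplaceKernel α c s) (Ioi 0) := by
  refine (integrableOn_exp_mul_rpow hα hs).mono'
    (measurable_laplaceKernel α c s).aestronglyMeasurable ?_
  refine (ae_restrict_iff' measurableSet_Ioi).2 (ae_of_all _ fun τ (hτ : 0 < τ) => ?_)
  rw [Real.norm_eq_abs, abs_of_nonneg (laplaceKernel_nonneg hτ)]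
  exact laplaceKernel_le hc hτ

lemma hasDerivAt_laplaceIntegral {α c s : ℝ} (hα : 0 < α) (hc : 0 ≤ c) (hs : 0 < s) :
    HasDerivAt (laplaceIntegral α c) (-laplaceIntegral (α + 1) c s) s := by
  have hs2 : 0 < s / 2 := by linarith
  have h := hasDerivAt_integral_of_dominated_loc_of_deriv_le (μ := volume.restrict (Ioi (0 : ℝ)))
    (F := laplaceKernel α c) (F' := fun s τ => -laplaceKernel (α + 1) c s τ) (x₀ := s)
    (bound := fun τ => Real.exp (-(s / 2 * τ)) * τ ^ (α + 1 - 1))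
    (Ioi_mem_nhds (by linarith : s / 2 < s))
    (Eventually.of_forall fun s => (measurable_laplaceKernel α c s).aestronglyMeasurable)
    (integrableOn_laplaceKernel hα hc hs)
    (measurable_laplaceKernel (α + 1) c s).neg.aestronglyMeasurable
    ?_ (integrableOn_exp_mul_rpow (by linarith) hs2) ?_
  · have h2 := h.2
    rw [integral_neg] at h2
    exact h2
  · refine (ae_restrict_iff' measurableSet_Ioi).2 (ae_of_all _ fun τ (hτ : 0 < τ) x hx => ?_)
    rw [norm_neg, Real.norm_eq_abs, abs_of_nonneg (laplaceKernel_nonneg hτ)]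
    refine (laplaceKernel_le hc hτ).trans ?_
    have : s / 2 ≤ x := le_of_lt hx
    gcongr
  · refine (ae_restrict_iff' measurableSet_Ioi).2 (ae_of_all _ fun τ (hτ : 0 < τ) x hx => ?_)
    have h1 : HasDerivAt (fun x => Real.exp (-(x * τ))) (Real.exp (-(x * τ)) * -(1 * τ)) x :=
      ((hasDerivAt_id x).mul_const τ).neg.exp
    refine ((h1.mul_const (τ ^ (α - 1))).mul_const ((1 + τ) ^ (-c))).congr_deriv ?_
    have e : τ ^ (α + 1 - 1) = τ ^ (α - 1) * τ := by
      rw [← Real.rpow_add_one hτ.ne']; congr 1; ring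
    simp only [laplaceKernel, e]
    ring

lemma laplaceIntegral_ode {a b s : ℝ} (ha : 0 < a) (hc : 0 ≤ a - b + 1) (hs : 0 < s) :
    a * laplaceIntegral a (a - b + 1) s + (b - s) * laplaceIntegral (a + 1) (a - b + 1) s
      - s * laplaceIntegral (a + 1 + 1) (a - b + 1) s = 0 := by
  set c := a - b + 1 with hcdef
  have i0 := integrableOn_laplaceKernel ha hc hs
  have i1 := integrableOn_laplaceKernel (α := a + 1) (by linarith) hc hs
  have i2 := integrableOn_laplaceKernel (α := a + 1 + 1) (by linarith) hc hs
  have i01 : IntegrableOn (fun x => a * laplaceKernel a c s x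
      + (b - s) * laplaceKernel (a + 1) c s x) (Ioi 0) :=
    (i0.const_mul a).add (i1.const_mul (b - s))
  have hint : IntegrableOn (fun x => a * laplaceKernel a c s x
      + (b - s) * laplaceKernel (a + 1) c s x - s * laplaceKernel (a + 1 + 1) c s x) (Ioi 0) :=
    i01.sub (i2.const_mul s)
  -- The combined integrand is the exact τ-derivative of e^{-sτ} τ^a (1+τ)^{1-c}, which vanishes at
  -- 0 because a > 0 and at ∞ because s > 0.
  have key := integral_Ioi_of_hasDerivAt_of_tendsto (a := (0 : ℝ)) (m := 0)
    (f := fun τ => Real.exp (-(s * τ)) * τ ^ a * (1 + τ) ^ (-c + 1)) ?_ ?_ hint ?_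
  · rw [integral_sub i01 (i2.const_mul s),
      integral_add (i0.const_mul a) (i1.const_mul (b - s)), integral_const_mul,
      integral_const_mul, integral_const_mul] at key
    simpa [Real.zero_rpow ha.ne', laplaceIntegral] using key
  · have h1 : ContinuousAt (fun τ : ℝ => (1 + τ) ^ (-c + 1)) 0 :=
      ContinuousAt.rpow_const (by fun_prop) (Or.inl (by norm_num))
    have h2 : Continuous fun τ : ℝ => Real.exp (-(s * τ)) * τ ^ a :=
      (by fun_prop : Continuous fun τ : ℝ => Real.exp (-(s * τ))).mul
        (Real.continuous_rpow_const ha.le)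
    exact (h2.continuousAt.mul h1).continuousWithinAt
  · intro τ (hτ : 0 < τ)
    have h1 : HasDerivAt (fun τ => Real.exp (-(s * τ))) (Real.exp (-(s * τ)) * -(s * 1)) τ :=
      ((hasDerivAt_id τ).const_mul s).neg.exp
    have h2 := Real.hasDerivAt_rpow_const (p := a) (Or.inl hτ.ne')
    have h3 : HasDerivAt (fun τ : ℝ => (1 + τ) ^ (-c + 1))
        (1 * (-c + 1) * (1 + τ) ^ (-c + 1 - 1)) τ :=
      ((hasDerivAt_id τ).const_add 1).rpow_const (Or.inl (by simp only [id]; positivity))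
    refine ((h1.mul h2).mul h3).congr_deriv ?_
    have e0 : τ ^ a = τ ^ (a - 1) * τ := by
      rw [← Real.rpow_add_one hτ.ne']; congr 1; ring
    have e1 : τ ^ (a + 1 - 1) = τ ^ (a - 1) * τ := by
      rw [← Real.rpow_add_one hτ.ne']; congr 1; ring
    have e2 : τ ^ (a + 1 + 1 - 1) = τ ^ (a - 1) * τ * τ := by
      rw [← Real.rpow_add_one hτ.ne', ← Real.rpow_add_one hτ.ne']; congr 1; ring
    have e3 : (1 + τ) ^ (-c + 1) = (1 + τ) ^ (-c) * (1 + τ) :=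
      Real.rpow_add_one (by positivity) _
    have e4 : (1 + τ) ^ (-c + 1 - 1) = (1 + τ) ^ (-c) := by congr 1; ring
    simp only [Pi.mul_apply, laplaceKernel, e1, e2, e3, e4, e0]
    rw [hcdef]
    ring
  · have t0 : Tendsto (fun τ : ℝ => τ ^ a * Real.exp (-s * τ) + τ ^ (a + 1) * Real.exp (-s * τ))
        atTop (𝓝 0) := by
      simpa using (tendsto_rpow_mul_exp_neg_mul_atTop_nhds_zero a s hs).add
        (tendsto_rpow_mul_exp_neg_mul_atTop_nhds_zero (a + 1) s hs)
    refine squeeze_zero' ?_ ?_ t0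
    · filter_upwards [eventually_gt_atTop 0] with τ hτ
      positivity
    · filter_upwards [eventually_gt_atTop 0] with τ hτ
      rw [Real.rpow_add_one (by positivity : (1 + τ) ≠ 0), Real.rpow_add_one hτ.ne']
      have h1 := one_add_rpow_neg_le_one hc hτ.le
      calc _ ≤ Real.exp (-(s * τ)) * τ ^ a * (1 * (1 + τ)) := by gcongr
        _ = _ := by rw [← neg_mul]; ring

/-- The Beta integral: write Γ(c)(1+τ)^{-c} as an integral of e^{-(1+τ)y} y^{c-1} and exchange the
order. With nonnegative integrands Tonelli needs no integrability, which is instead deduced from the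
finite value. -/
lemma lintegral_rpow_mul_one_add_rpow {a c : ℝ} (ha : 0 < a) (hac : a < c) :
    ∫⁻ τ in Ioi (0 : ℝ), ENNReal.ofReal (Real.Gamma c * (τ ^ (a - 1) * (1 + τ) ^ (-c)))
      = ENNReal.ofReal (Real.Gamma a * Real.Gamma (c - a)) := by
  have hc : 0 < c := ha.trans hac
  set K : ℝ → ℝ → ℝ := fun τ y => τ ^ (a - 1) * (Real.exp (-((1 + τ) * y)) * y ^ (c - 1)) with hK
  have h1 : ∀ τ ∈ Ioi (0 : ℝ), ENNReal.ofReal (Real.Gamma c * (τ ^ (a - 1) * (1 + τ) ^ (-c)))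
      = ∫⁻ y in Ioi (0 : ℝ), ENNReal.ofReal (K τ y) := by
    intro τ (hτ : 0 < τ)
    have h1τ : 0 < 1 + τ := by linarith
    rw [← ofReal_integral_eq_lintegral_ofReal ((integrableOn_exp_mul_rpow hc h1τ).const_mul _),
      integral_const_mul, integral_exp_mul_rpow hc h1τ]
    · congr 1; ring
    · refine (ae_restrict_iff' measurableSet_Ioi).2 (ae_of_all _ fun y (hy : 0 < y) => ?_)
      simp only [Pi.zero_apply]
      positivity
  have h2 : ∀ y ∈ Ioi (0 : ℝ), ∫⁻ τ in Ioi (0 : ℝ), ENNReal.ofReal (K τ y)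
      = ENNReal.ofReal (Real.Gamma a * (Real.exp (-(1 * y)) * y ^ (c - a - 1))) := by
    intro y (hy : 0 < y)
    have e : ∀ τ, K τ y
        = (Real.exp (-y) * y ^ (c - 1)) * (Real.exp (-(y * τ)) * τ ^ (a - 1)) := by
      intro τ
      simp only [hK]
      rw [show -((1 + τ) * y) = -y + -(y * τ) by ring, Real.exp_add]
      ring
    simp_rw [e]
    rw [← ofReal_integral_eq_lintegral_ofReal ((integrableOn_exp_mul_rpow ha hy).const_mul _),
      integral_const_mul, integral_exp_mul_rpow ha hy]
    · congr 1
      rw [show c - a - 1 = (c - 1) + -a by ring, Real.rpow_add hy]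
      ring_nf
    · refine (ae_restrict_iff' measurableSet_Ioi).2 (ae_of_all _ fun τ (hτ : 0 < τ) => ?_)
      simp only [Pi.zero_apply]
      positivity
  rw [setLIntegral_congr_fun measurableSet_Ioi h1, lintegral_lintegral_swap,
    setLIntegral_congr_fun measurableSet_Ioi h2,
    ← ofReal_integral_eq_lintegral_ofReal
      ((integrableOn_exp_mul_rpow (by linarith) one_pos).const_mul _),
    integral_const_mul, integral_exp_mul_rpow (by linarith) one_pos]
  · simp
  · refine (ae_restrict_iff' measurableSet_Ioi).2 (ae_of_all _ fun y (hy : 0 < y) => ?_)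
    have := Real.Gamma_pos_of_pos ha
    simp only [Pi.zero_apply]
    positivity
  · refine Measurable.aemeasurable ?_
    simp only [hK, Function.uncurry_def]
    fun_prop

lemma integrableOn_rpow_mul_one_add_rpow {a c : ℝ} (ha : 0 < a) (hac : a < c) :
    IntegrableOn (fun τ : ℝ => τ ^ (a - 1) * (1 + τ) ^ (-c)) (Ioi 0) := by
  have hc := Real.Gamma_pos_of_pos (ha.trans hac)
  have h : IntegrableOn (fun τ : ℝ => Real.Gamma c * (τ ^ (a - 1) * (1 + τ) ^ (-c))) (Ioi 0) := by
    refine (lintegral_ofReal_ne_top_iff_integrable (Measurable.aestronglyMeasurable (by fun_prop))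
      ?_).1 ?_
    · refine (ae_restrict_iff' measurableSet_Ioi).2 (ae_of_all _ fun y (hy : 0 < y) => ?_)
      simp only [Pi.zero_apply]
      positivity
    · rw [lintegral_rpow_mul_one_add_rpow ha hac]
      exact ENNReal.ofReal_ne_top
  have h' := h.const_mul (Real.Gamma c)⁻¹
  refine h'.congr (ae_of_all _ fun τ => ?_)
  simp only
  field_simp

lemma integral_rpow_mul_one_add_rpow {a c : ℝ} (ha : 0 < a) (hac : a < c) :
    ∫ τ in Ioi (0 : ℝ), τ ^ (a - 1) * (1 + τ) ^ (-c)
      = Real.Gamma a * Real.Gamma (c - a) / Real.Gamma c := by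
  have hc := Real.Gamma_pos_of_pos (ha.trans hac)
  have ha' := Real.Gamma_pos_of_pos ha
  have hca := Real.Gamma_pos_of_pos (sub_pos.2 hac)
  have h := lintegral_rpow_mul_one_add_rpow ha hac
  rw [← ofReal_integral_eq_lintegral_ofReal
    ((integrableOn_rpow_mul_one_add_rpow ha hac).const_mul _), integral_const_mul] at h
  · rw [eq_div_iff hc.ne', mul_comm]
    refine (ENNReal.ofReal_eq_ofReal_iff (mul_nonneg hc.le ?_) (by positivity)).1 h
    exact setIntegral_nonneg measurableSet_Ioi fun τ (hτ : 0 < τ) => by positivity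
  · refine (ae_restrict_iff' measurableSet_Ioi).2 (ae_of_all _ fun y (hy : 0 < y) => ?_)
    simp only [Pi.zero_apply]
    positivity

lemma tendsto_laplaceIntegral {a c : ℝ} (ha : 0 < a) (hac : a < c) :
    Tendsto (laplaceIntegral a c) (𝓝[>] 0)
      (𝓝 (Real.Gamma a * Real.Gamma (c - a) / Real.Gamma c)) := by
  rw [← integral_rpow_mul_one_add_rpow ha hac]
  refine tendsto_integral_filter_of_dominated_convergence _ (Eventually.of_forall fun s =>
    (measurable_laplaceKernel a c s).aestronglyMeasurable) ?_
    (integrableOn_rpow_mul_one_add_rpow ha hac) ?_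
  · filter_upwards [self_mem_nhdsWithin] with s (hs : 0 < s)
    refine (ae_restrict_iff' measurableSet_Ioi).2 (ae_of_all _ fun τ (hτ : 0 < τ) => ?_)
    rw [Real.norm_eq_abs, abs_of_nonneg (laplaceKernel_nonneg hτ), laplaceKernel, mul_assoc]
    refine mul_le_of_le_one_left (by positivity) ?_
    rw [Real.exp_le_one_iff]
    have : 0 < s * τ := by positivity
    linarith
  · refine ae_of_all _ fun τ => ?_
    have h : Continuous fun s => laplaceKernel a c s τ := by
      unfold laplaceKernel
      fun_prop
    have := (h.tendsto 0).mono_left (nhdsWithin_le_nhds (s := Ioi (0 : ℝ)))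
    simpa [laplaceKernel] using this

lemma laplaceIntegral_scale {α c s : ℝ} (hs : 0 < s) :
    s ^ α * laplaceIntegral α c s
      = ∫ u in Ioi (0 : ℝ), Real.exp (-(1 * u)) * u ^ (α - 1) * (1 + u / s) ^ (-c) := by
  have h := integral_comp_mul_left_Ioi
    (fun u => Real.exp (-(1 * u)) * u ^ (α - 1) * (1 + u / s) ^ (-c)) 0 hs
  rw [mul_zero, smul_eq_mul, eq_inv_mul_iff_mul_eq₀ hs.ne'] at h
  rw [← h, laplaceIntegral, ← integral_const_mul, ← integral_const_mul]
  refine setIntegral_congr_fun measurableSet_Ioi fun τ (hτ : 0 < τ) => ?_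
  have e : s ^ α = s * s ^ (α - 1) := by
    rw [mul_comm, ← Real.rpow_add_one hs.ne']; congr 1; ring
  simp only [laplaceKernel, one_mul]
  rw [Real.mul_rpow hs.le hτ.le, mul_div_cancel_left₀ _ hs.ne', e]
  ring

/-- After u = sτ the quantity is ∫ e^{-u} u^a (s+u)^{-(a-b+1)} du, dominated by its limiting
integrand e^{-u} u^{b-1} at s = 0. -/
lemma tendsto_rpow_mul_laplaceIntegral {a b : ℝ} (ha : 0 < a) (hb0 : 0 < b) (hb1 : b < 1) :
    Tendsto (fun s => s ^ b * laplaceIntegral (a + 1) (a - b + 1) s) (𝓝[>] 0)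
      (𝓝 (Real.Gamma b)) := by
  have hc : 0 ≤ a - b + 1 := by linarith
  have e0 : Real.Gamma b = ∫ u in Ioi (0 : ℝ), Real.exp (-(1 * u)) * u ^ (b - 1) := by
    rw [integral_exp_mul_rpow hb0 one_pos]; simp
  have e1 : ∀ s : ℝ, 0 < s → ∫ u in Ioi (0 : ℝ), Real.exp (-(1 * u)) * u ^ a
      * (s + u) ^ (-(a - b + 1)) = s ^ b * laplaceIntegral (a + 1) (a - b + 1) s := by
    intro s hs
    have h := laplaceIntegral_scale (α := a + 1) (c := a - b + 1) hs
    have e2 : s ^ b = s ^ (-(a - b + 1)) * s ^ (a + 1) := by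
      rw [← Real.rpow_add hs]; congr 1; ring
    rw [e2, mul_assoc, h, ← integral_const_mul]
    refine setIntegral_congr_fun measurableSet_Ioi fun u (hu : 0 < u) => ?_
    have e3 : s + u = s * (1 + u / s) := by field_simp
    rw [e3, Real.mul_rpow hs.le (by positivity), add_sub_cancel_right]
    ring
  have key : Tendsto (fun s => ∫ u in Ioi (0 : ℝ), Real.exp (-(1 * u)) * u ^ a
      * (s + u) ^ (-(a - b + 1))) (𝓝[>] 0) (𝓝 (Real.Gamma b)) := by
    rw [e0]
    refine tendsto_integral_filter_of_dominated_convergence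
      (fun u => Real.exp (-(1 * u)) * u ^ (b - 1))
      (Eventually.of_forall fun s => Measurable.aestronglyMeasurable (by fun_prop)) ?_
      (integrableOn_exp_mul_rpow hb0 one_pos) ?_
    · filter_upwards [self_mem_nhdsWithin] with s (hs : 0 < s)
      refine (ae_restrict_iff' measurableSet_Ioi).2 (ae_of_all _ fun u (hu : 0 < u) => ?_)
      rw [Real.norm_eq_abs, abs_of_nonneg (by positivity), mul_assoc]
      gcongr
      calc u ^ a * (s + u) ^ (-(a - b + 1)) ≤ u ^ a * u ^ (-(a - b + 1)) := by
            gcongr ?_ * ?_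
            exact Real.rpow_le_rpow_of_nonpos hu (by linarith) (by linarith)
        _ = u ^ (b - 1) := by rw [← Real.rpow_add hu]; congr 1; ring
    · refine (ae_restrict_iff' measurableSet_Ioi).2 (ae_of_all _ fun u (hu : 0 < u) => ?_)
      have h1 : ContinuousAt (fun s : ℝ => (s + u) ^ (-(a - b + 1))) 0 :=
        ContinuousAt.rpow_const (by fun_prop) (Or.inl (by simpa using hu.ne'))
      have h2 := (h1.tendsto.const_mul (Real.exp (-(1 * u)) * u ^ a)).mono_left
        (nhdsWithin_le_nhds (s := Ioi (0 : ℝ)))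
      convert h2 using 2
      rw [zero_add, mul_assoc, ← Real.rpow_add hu]
      congr 2
      ring
  refine key.congr' ?_
  filter_upwards [self_mem_nhdsWithin] with s hs using e1 s hs

/-- These data are the ones of Γ(a)U(a,b,·); uniqueness then identifies the two functions. -/
lemma isKummerSolution_laplaceIntegral {a b : ℝ} (ha : 0 < a) (hb0 : 0 < b) (hb1 : b < 1) :
    IsKummerSolution 1 a b (laplaceIntegral a (a - b + 1))
      (fun s => -laplaceIntegral (a + 1) (a - b + 1) s)
      (Real.Gamma a * Real.Gamma (1 - b) / Real.Gamma (a - b + 1)) (-Real.Gamma b) where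
  hasDerivAt s hs := hasDerivAt_laplaceIntegral ha (by linarith) hs
  hasDerivAt' s hs := by
    refine (hasDerivAt_laplaceIntegral (α := a + 1) (by linarith) (by linarith) hs).neg.congr_deriv
      ?_
    rw [eq_div_iff hs.ne']
    linear_combination -laplaceIntegral_ode ha (by linarith : 0 ≤ a - b + 1) hs
  tendsto := by
    have h := tendsto_laplaceIntegral (c := a - b + 1) ha (by linarith)
    rwa [show a - b + 1 - a = 1 - b by ring] at h
  tendsto' := by
    simpa using (tendsto_rpow_mul_laplaceIntegral ha hb0 hb1).neg

/-! ### Two-term expansion of U at infinity -/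

lemma one_sub_mul_le_one_add_rpow_neg {c x : ℝ} (hc : 0 ≤ c) (hx : 0 ≤ x) :
    1 - c * x ≤ (1 + x) ^ (-c) := by
  have h1 : 0 < 1 + x := by linarith
  rw [Real.rpow_def_of_pos h1]
  have h2 := Real.add_one_le_exp (Real.log (1 + x) * -c)
  have h3 := Real.log_le_sub_one_of_pos h1
  nlinarith

/-- The right side minus the left vanishes at 0 and is nondecreasing: its derivative is c times the
gap in the first-order bound with c+1 in place of c. -/
lemma one_add_rpow_neg_le {c x : ℝ} (hc : 0 ≤ c) (hx : 0 ≤ x) :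
    (1 + x) ^ (-c) ≤ 1 - c * x + c * (c + 1) / 2 * x ^ 2 := by
  set φ : ℝ → ℝ := fun x => 1 - c * x + c * (c + 1) / 2 * x ^ 2 - (1 + x) ^ (-c) with hφ
  have hd : ∀ y, 0 ≤ y → HasDerivAt φ (c * ((1 + y) ^ (-(c + 1)) - (1 - (c + 1) * y))) y := by
    intro y hy
    have h3 : HasDerivAt (fun y : ℝ => (1 + y) ^ (-c)) (1 * (-c) * (1 + y) ^ (-c - 1)) y :=
      ((hasDerivAt_id y).const_add 1).rpow_const (Or.inl (by simp only [id]; positivity))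
    have h4 := (((hasDerivAt_id y).const_mul c).const_sub 1).add
      ((hasDerivAt_pow 2 y).const_mul (c * (c + 1) / 2))
    refine (h4.sub h3).congr_deriv ?_
    rw [show -c - 1 = -(c + 1) by ring]
    push_cast
    ring
  have hm : MonotoneOn φ (Ici 0) := by
    refine monotoneOn_of_deriv_nonneg (convex_Ici 0)
      (fun y hy => (hd y hy).continuousAt.continuousWithinAt)
      (fun y hy => (hd y (interior_subset hy)).differentiableAt.differentiableWithinAt)
      fun y hy => ?_
    rw [(hd y (interior_subset hy)).deriv]
    have := one_sub_mul_le_one_add_rpow_neg (c := c + 1) (by linarith) (interior_subset hy)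
    exact mul_nonneg hc (by linarith)
  have := hm (mem_Ici.2 le_rfl) (mem_Ici.2 hx) hx
  simp only [hφ] at this
  norm_num at this
  linarith

/-- Watson's lemma with an explicit remainder: rescale u = sτ, bracket (1+u/s)^{-c} between its
Taylor polynomials of degrees 1 and 2, and integrate against e^{-u}u^{a-1}. -/
lemma abs_rpow_mul_laplaceIntegral_sub_le {a c s : ℝ} (ha : 0 < a) (hc : 0 ≤ c) (hs : 0 < s) :
    |s ^ a * laplaceIntegral a c s - (Real.Gamma a - c * Real.Gamma (a + 1) / s)|
      ≤ c * (c + 1) / 2 * Real.Gamma (a + 2) / s ^ 2 := by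
  have g : ∀ {α : ℝ}, 0 < α →
      ∫ u in Ioi (0 : ℝ), Real.exp (-(1 * u)) * u ^ (α - 1) = Real.Gamma α := by
    intro α hα
    rw [integral_exp_mul_rpow hα one_pos]; simp
  have i0 := integrableOn_exp_mul_rpow ha one_pos
  have i1 := integrableOn_exp_mul_rpow (α := a + 1) (by linarith) one_pos
  have i2 := integrableOn_exp_mul_rpow (α := a + 2) (by linarith) one_pos
  have p1 : ∀ u : ℝ, 0 < u → u ^ (a + 1 - 1) = u ^ (a - 1) * u := by
    intro u hu
    rw [← Real.rpow_add_one hu.ne']; congr 1; ring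
  have p2 : ∀ u : ℝ, 0 < u → u ^ (a + 2 - 1) = u ^ (a - 1) * u ^ 2 := by
    intro u hu
    rw [← Real.rpow_natCast, ← Real.rpow_add hu]; congr 1; push_cast; ring
  have i3 : IntegrableOn
      (fun u : ℝ => Real.exp (-(1 * u)) * u ^ (a - 1) * (1 + u / s) ^ (-c)) (Ioi 0) := by
    refine i0.mono' (Measurable.aestronglyMeasurable (by fun_prop)) ?_
    refine (ae_restrict_iff' measurableSet_Ioi).2 (ae_of_all _ fun u (hu : 0 < u) => ?_)
    rw [Real.norm_eq_abs, abs_of_nonneg (by positivity)]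
    exact mul_le_of_le_one_right (by positivity) (one_add_rpow_neg_le_one hc (by positivity))
  rw [laplaceIntegral_scale hs]
  have e : Real.Gamma a - c * Real.Gamma (a + 1) / s
      = ∫ u in Ioi (0 : ℝ), (Real.exp (-(1 * u)) * u ^ (a - 1)
        - c / s * (Real.exp (-(1 * u)) * u ^ (a + 1 - 1))) := by
    rw [integral_sub i0 (i1.const_mul _), integral_const_mul, g ha, g (by linarith)]
    ring
  have e' : c * (c + 1) / 2 * Real.Gamma (a + 2) / s ^ 2
      = ∫ u in Ioi (0 : ℝ), c * (c + 1) / 2 / s ^ 2 * (Real.exp (-(1 * u)) * u ^ (a + 2 - 1)) := by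
    rw [integral_const_mul, g (by linarith)]
    ring
  have hi : IntegrableOn (fun u : ℝ => Real.exp (-(1 * u)) * u ^ (a - 1)
      - c / s * (Real.exp (-(1 * u)) * u ^ (a + 1 - 1))) (Ioi 0) := i0.sub (i1.const_mul (c / s))
  rw [e, e', ← integral_sub i3 hi, ← Real.norm_eq_abs]
  refine norm_integral_le_of_norm_le (i2.const_mul _) ?_
  refine (ae_restrict_iff' measurableSet_Ioi).2 (ae_of_all _ fun u (hu : 0 < u) => ?_)
  have hx : 0 ≤ u / s := by positivity
  have l1 := one_sub_mul_le_one_add_rpow_neg hc hx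
  have l2 := one_add_rpow_neg_le hc hx
  have hp : 0 ≤ Real.exp (-(1 * u)) * u ^ (a - 1) := by positivity
  calc _ = |Real.exp (-(1 * u)) * u ^ (a - 1) * ((1 + u / s) ^ (-c) - (1 - c * (u / s)))| := by
        rw [Real.norm_eq_abs, p1 u hu]
        congr 1
        ring
    _ = Real.exp (-(1 * u)) * u ^ (a - 1) * ((1 + u / s) ^ (-c) - (1 - c * (u / s))) := by
        rw [abs_of_nonneg (mul_nonneg hp (by linarith))]
    _ ≤ Real.exp (-(1 * u)) * u ^ (a - 1) * (c * (c + 1) / 2 * (u / s) ^ 2) := by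
        gcongr
        linarith
    _ = _ := by
        rw [p2 u hu]
        ring

/-- Tricomi's function `U(a,b,s)` for real `a`, `s > 0` and `b ∉ ℤ`. -/
def tricomiReal (a b s : ℝ) : ℝ :=
  Real.Gamma (1 - b) * (Real.Gamma (a - b + 1))⁻¹ * kummerReal a b s
    + Real.Gamma (b - 1) * (Real.Gamma a)⁻¹ * (s ^ (1 - b) * kummerReal (a - b + 1) (2 - b) s)

/-- Valid without exceptions, since `Real.Gamma` is 0 at the poles and so its inverse is the value
of the entire function 1/Γ. -/
lemma inv_Gamma_eq_mul (x : ℝ) : (Real.Gamma x)⁻¹ = x * (Real.Gamma (x + 1))⁻¹ := by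
  rcases eq_or_ne x 0 with rfl | hx
  · simp [Real.Gamma_zero]
  · rw [Real.Gamma_add_one hx]
    field_simp

lemma laplaceIntegral_eq_Gamma_mul_tricomiReal {a b : ℝ} (ha : 0 < a) (hb0 : 0 < b) (hb1 : b < 1)
    {s : ℝ} (hs : 0 < s) :
    laplaceIntegral a (a - b + 1) s = Real.Gamma a * tricomiReal a b s := by
  have h := (isKummerSolution_laplaceIntegral ha hb0 hb1).eq_kummerReal hb0 hb1 hs
  have hΓ := (Real.Gamma_pos_of_pos ha).ne'
  have hb : 1 - b ≠ 0 := by linarith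
  have e : Real.Gamma b = (b - 1) * Real.Gamma (b - 1) := by
    rw [← Real.Gamma_add_one (by linarith), sub_add_cancel]
  rw [h, tricomiReal, one_mul, e]
  field_simp
  ring

/-- Both M-terms satisfy three-term relations in a; the shifts of the 1/Γ factors turn them into one
recurrence for U, with no restriction on a. -/
lemma tricomiReal_contiguous {b : ℝ} (hb0 : 0 < b) (hb1 : b < 1) (a s : ℝ) :
    tricomiReal (a - 1) b s = (s + 2 * a - b) * tricomiReal a b s
      - a * (a - b + 1) * tricomiReal (a + 1) b s := by
  have h1 := kummerReal_contiguous hb0 a s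
  have h2 := kummerReal_contiguous (b := 2 - b) (by linarith) (a - b + 1) s
  have g1 := inv_Gamma_eq_mul (a - b)
  have g2 := inv_Gamma_eq_mul (a - b + 1)
  have g3 := inv_Gamma_eq_mul (a - 1)
  have g4 := inv_Gamma_eq_mul a
  rw [sub_add_cancel] at g3
  simp only [tricomiReal, show a - 1 - b + 1 = a - b by ring,
    show a + 1 - b + 1 = a - b + 1 + 1 by ring, g1, g3]
  rw [show a - b + 1 - 1 = a - b by ring] at h2
  linear_combination (-Real.Gamma (1 - b) * (Real.Gamma (a - b + 1))⁻¹) * h1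
    - (Real.Gamma (b - 1) * (Real.Gamma a)⁻¹ * s ^ (1 - b)) * h2
    - (Real.Gamma (1 - b) * a * kummerReal (a + 1) b s) * g2
    - (Real.Gamma (b - 1) * s ^ (1 - b) * (a - b + 1)
      * kummerReal (a - b + 1 + 1) (2 - b) s) * g4

lemma isBigO_tricomiReal_of_pos {a b : ℝ} (ha : 0 < a) (hb0 : 0 < b) (hb1 : b < 1) :
    (fun s => s ^ a * tricomiReal a b s - (1 - a * (a - b + 1) / s)) =O[atTop]
      fun s : ℝ => (s ^ 2)⁻¹ := by
  set c := a - b + 1 with hc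
  have hc0 : 0 ≤ c := by linarith
  have hΓ := Real.Gamma_pos_of_pos ha
  refine IsBigO.of_bound ((Real.Gamma a)⁻¹ * (c * (c + 1) / 2 * Real.Gamma (a + 2))) ?_
  filter_upwards [eventually_gt_atTop 0] with s hs
  have h := abs_rpow_mul_laplaceIntegral_sub_le ha hc0 hs
  rw [laplaceIntegral_eq_Gamma_mul_tricomiReal ha hb0 hb1 hs, Real.Gamma_add_one ha.ne'] at h
  have e : s ^ a * tricomiReal a b s - (1 - a * c / s) = (Real.Gamma a)⁻¹ *
      (s ^ a * (Real.Gamma a * tricomiReal a b s)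
        - (Real.Gamma a - c * (a * Real.Gamma a) / s)) := by
    field_simp
  rw [e, norm_mul, Real.norm_eq_abs, Real.norm_eq_abs, Real.norm_eq_abs,
    abs_of_pos (inv_pos.2 hΓ), mul_assoc, abs_of_pos (by positivity : 0 < (s ^ 2)⁻¹)]
  gcongr
  exact h

lemma tendsto_one_of_isBigO_inv_sq {f : ℝ → ℝ} {c : ℝ}
    (h : (fun s => f s - (1 - c / s)) =O[atTop] fun s : ℝ => (s ^ 2)⁻¹) :
    Tendsto f atTop (𝓝 1) := by
  have h1 : Tendsto (fun s : ℝ => (s ^ 2)⁻¹) atTop (𝓝 0) :=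
    tendsto_inv_atTop_zero.comp (tendsto_pow_atTop two_ne_zero)
  have h2 := h.trans_tendsto h1
  have h3 : Tendsto (fun s : ℝ => 1 - c / s) atTop (𝓝 (1 - 0)) :=
    tendsto_const_nhds.sub (tendsto_const_nhds.div_atTop tendsto_id)
  simpa using h2.add h3

/-- Induction lowering a by one. The recurrence gives s^a U(a) = (1 + (2(a+1)-b)/s)·s^{a+1}U(a+1) -
(c/s²)·s^{a+2}U(a+2), c = (a+1)(a+2-b). The last factor only needs to be bounded, and the 1/s
coefficients match by a(a-b+1) = c - (2(a+1)-b). -/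
lemma isBigO_tricomiReal_of_neg_lt {b : ℝ} (hb0 : 0 < b) (hb1 : b < 1) (n : ℕ) :
    ∀ a : ℝ, -(n : ℝ) < a →
      (fun s => s ^ a * tricomiReal a b s - (1 - a * (a - b + 1) / s)) =O[atTop]
        fun s : ℝ => (s ^ 2)⁻¹ := by
  induction n with
  | zero => exact fun a ha => isBigO_tricomiReal_of_pos (by simpa using ha) hb0 hb1
  | succ n ih =>
    intro a ha
    push_cast at ha
    have h1 := ih (a + 1) (by linarith)
    have h2 := ih (a + 1 + 1) (by linarith)
    have b2 := (tendsto_one_of_isBigO_inv_sq h2).isBigO_one ℝ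
    set c := (a + 1) * (a + 1 - b + 1) with hc
    have b1 : (fun s : ℝ => 1 + (2 * (a + 1) - b) / s) =O[atTop] fun _ => (1 : ℝ) := by
      have : Tendsto (fun s : ℝ => 1 + (2 * (a + 1) - b) / s) atTop (𝓝 (1 + 0)) :=
        tendsto_const_nhds.add (tendsto_const_nhds.div_atTop tendsto_id)
      exact this.isBigO_one ℝ
    have r := isBigO_refl (fun s : ℝ => (s ^ 2)⁻¹) atTop
    have t1 := r.const_mul_left (-(2 * (a + 1) - b) * c)
    have t2 := b1.mul h1
    have t3 := (r.mul b2).const_mul_left c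
    simp only [one_mul, mul_one] at t2 t3
    refine ((t1.add t2).sub t3).congr' ?_ EventuallyEq.rfl
    filter_upwards [eventually_gt_atTop 0] with s hs
    have hrec := tricomiReal_contiguous hb0 hb1 (a + 1) s
    rw [add_sub_cancel_right] at hrec
    have e1 : s ^ (a + 1) = s ^ a * s := Real.rpow_add_one hs.ne' _
    have e2 : s ^ (a + 1 + 1) = s ^ a * s * s := by
      rw [Real.rpow_add_one hs.ne', e1]
    rw [hrec, e1, e2, ← hc]
    have hc' : a * (a - b + 1) = c - (2 * (a + 1) - b) := by rw [hc]; ring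
    rw [hc']
    field_simp
    ring

/-- The two leading terms of the expansion of `U(a,b,s)` as `s → ∞`. -/
lemma isBigO_tricomiReal {b : ℝ} (hb0 : 0 < b) (hb1 : b < 1) (a : ℝ) :
    (fun s => s ^ a * tricomiReal a b s - (1 - a * (a - b + 1) / s)) =O[atTop]
      fun s : ℝ => (s ^ 2)⁻¹ := by
  obtain ⟨n, hn⟩ := exists_nat_gt (-a)
  exact isBigO_tricomiReal_of_neg_lt hb0 hb1 n a (by linarith)

lemma tendsto_rpow_mul_tricomiReal {b : ℝ} (hb0 : 0 < b) (hb1 : b < 1) (a : ℝ) :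
    Tendsto (fun s => s ^ a * tricomiReal a b s) atTop (𝓝 1) :=
  tendsto_one_of_isBigO_inv_sq (isBigO_tricomiReal hb0 hb1 a)

lemma tendsto_mul_rpow_mul_tricomiReal_sub_one {b : ℝ} (hb0 : 0 < b) (hb1 : b < 1) (a : ℝ) :
    Tendsto (fun s => s * (s ^ a * tricomiReal a b s - 1)) atTop (𝓝 (-(a * (a - b + 1)))) := by
  have h := (isBigO_refl (fun s : ℝ => s) atTop).mul (isBigO_tricomiReal hb0 hb1 a)
  have h1 : Tendsto (fun s : ℝ => s * (s ^ 2)⁻¹) atTop (𝓝 0) := by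
    refine tendsto_inv_atTop_zero.congr' ?_
    filter_upwards [eventually_gt_atTop 0] with s hs
    field_simp
  have h2 := (h.trans_tendsto h1).add_const (-(a * (a - b + 1)))
  rw [zero_add] at h2
  refine h2.congr' ?_
  filter_upwards [eventually_gt_atTop 0] with s hs
  field_simp
  ring

lemma tendsto_mul_rpow_mul_exp_mul_tricomiReal {b : ℝ} (hb0 : 0 < b) (hb1 : b < 1) (a a' : ℝ) :
    Tendsto (fun s => s * (s ^ a' * (Real.exp (-s) * tricomiReal a b s))) atTop (𝓝 0) := by
  have h1 := tendsto_rpow_mul_exp_neg_mul_atTop_nhds_zero (1 + a' - a) 1 one_pos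
  have h2 := h1.mul (tendsto_rpow_mul_tricomiReal hb0 hb1 a)
  rw [zero_mul] at h2
  refine h2.congr' ?_
  filter_upwards [eventually_gt_atTop 0] with s hs
  rw [Real.rpow_sub hs, Real.rpow_add hs, Real.rpow_one, neg_one_mul]
  have : s ^ a ≠ 0 := (Real.rpow_pos_of_pos hs _).ne'
  field_simp

/-! ### The angular profile as an entire function of t -/

/-- The entire function of `t` which, for `t < 0`, equals `U(a, 2/3, -t³/9)`. -/
def entireProfile (a t : ℝ) : ℝ :=
  Real.Gamma (1 - 2 / 3) * (Real.Gamma (a - 2 / 3 + 1))⁻¹ * kummerReal a (2 / 3) (-t ^ 3 / 9)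
    - Real.Gamma (2 / 3 - 1) * (Real.Gamma a)⁻¹ * (9 : ℝ) ^ (-(1 / 3) : ℝ) *
      (t * kummerReal (a - 2 / 3 + 1) (2 - 2 / 3) (-t ^ 3 / 9))

/-- The derivative of `entireProfile a`. -/
def entireProfileDeriv (a t : ℝ) : ℝ :=
  Real.Gamma (1 - 2 / 3) * (Real.Gamma (a - 2 / 3 + 1))⁻¹ *
      (a / (2 / 3) * kummerReal (a + 1) (2 / 3 + 1) (-t ^ 3 / 9) * (-t ^ 2 / 3))
    - Real.Gamma (2 / 3 - 1) * (Real.Gamma a)⁻¹ * (9 : ℝ) ^ (-(1 / 3) : ℝ) *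
      (kummerReal (a - 2 / 3 + 1) (2 - 2 / 3) (-t ^ 3 / 9)
        + t * ((a - 2 / 3 + 1) / (2 - 2 / 3)
          * kummerReal (a - 2 / 3 + 1 + 1) (2 - 2 / 3 + 1) (-t ^ 3 / 9) * (-t ^ 2 / 3)))

lemma cube_div_nine_rpow {u : ℝ} (hu : 0 ≤ u) (p : ℝ) :
    (u ^ 3 / 9) ^ p = (9 : ℝ) ^ (-p) * u ^ (3 * p) := by
  rw [Real.div_rpow (by positivity) (by norm_num), ← Real.rpow_natCast, ← Real.rpow_mul hu,
    Real.rpow_neg (by norm_num)]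
  push_cast
  ring

lemma cube_div_nine_rpow_third {u : ℝ} (hu : 0 ≤ u) :
    (u ^ 3 / 9) ^ (1 - 2 / 3 : ℝ) = (9 : ℝ) ^ (-(1 / 3) : ℝ) * u := by
  rw [cube_div_nine_rpow hu]
  norm_num

lemma contDiff_entireProfile (a : ℝ) : ContDiff ℝ ∞ (entireProfile a) := by
  have h0 : ContDiff ℝ ∞ fun t : ℝ => -t ^ 3 / 9 := by fun_prop
  have h1 := (contDiff_kummerReal (b := 2 / 3) (by norm_num) a).comp h0
  have h2 := (contDiff_kummerReal (b := 2 - 2 / 3) (by norm_num) (a - 2 / 3 + 1)).comp h0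
  exact (contDiff_const.mul h1).sub (contDiff_const.mul (contDiff_id.mul h2))

lemma hasDerivAt_kummerReal_cube {b : ℝ} (hb : 0 < b) (a t : ℝ) :
    HasDerivAt (fun t => kummerReal a b (-t ^ 3 / 9))
      (a / b * kummerReal (a + 1) (b + 1) (-t ^ 3 / 9) * (-t ^ 2 / 3)) t := by
  have h : HasDerivAt (fun t : ℝ => -t ^ 3 / 9) (-t ^ 2 / 3) t := by
    refine ((hasDerivAt_pow 3 t).neg.div_const 9).congr_deriv ?_
    push_cast
    ring
  exact (hasDerivAt_kummerReal hb a _).comp t h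

lemma hasDerivAt_entireProfile (a t : ℝ) :
    HasDerivAt (entireProfile a) (entireProfileDeriv a t) t := by
  have h1 := hasDerivAt_kummerReal_cube (b := 2 / 3) (by norm_num) a t
  have h2 := (hasDerivAt_id t).mul
    (hasDerivAt_kummerReal_cube (b := 2 - 2 / 3) (by norm_num) (a - 2 / 3 + 1) t)
  refine ((h1.const_mul _).sub (h2.const_mul _)).congr_deriv ?_
  simp only [entireProfileDeriv, id, one_mul]

/-- Kummer's equation with b = 2/3 under s = -t³/9. In the variable t the two exponents 0 and 1/3 at
s = 0 become 0 and 1, which removes the singularity. -/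
lemma hasDerivAt_entireProfileDeriv (a t : ℝ) :
    HasDerivAt (entireProfileDeriv a)
      (-(t ^ 2 / 3 * entireProfileDeriv a t + a * t * entireProfile a t)) t := by
  have hq : HasDerivAt (fun t : ℝ => -t ^ 2 / 3) (-(2 * t) / 3) t := by
    refine ((hasDerivAt_pow 2 t).neg.div_const 3).congr_deriv ?_
    simp
  have h1 := ((hasDerivAt_kummerReal_cube (b := 2 / 3 + 1) (by norm_num) (a + 1) t).const_mul
    (a / (2 / 3))).mul hq
  have h2 := hasDerivAt_kummerReal_cube (b := 2 - 2 / 3) (by norm_num) (a - 2 / 3 + 1) t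
  have h3 := (hasDerivAt_id t).mul (((hasDerivAt_kummerReal_cube (b := 2 - 2 / 3 + 1)
    (by norm_num) (a - 2 / 3 + 1 + 1) t).const_mul ((a - 2 / 3 + 1) / (2 - 2 / 3))).mul hq)
  refine ((h1.const_mul _).sub ((h2.add h3).const_mul _)).congr_deriv ?_
  have o1 := kummerReal_ode (b := 2 / 3) (by norm_num) a (-t ^ 3 / 9)
  have o2 := kummerReal_ode (b := 2 - 2 / 3) (by norm_num) (a - 2 / 3 + 1) (-t ^ 3 / 9)
  simp only [entireProfileDeriv, entireProfile, id]
  generalize Real.Gamma (1 - 2 / 3) * (Real.Gamma (a - 2 / 3 + 1))⁻¹ = A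
  generalize Real.Gamma (2 / 3 - 1) * (Real.Gamma a)⁻¹ * (9 : ℝ) ^ (-(1 / 3) : ℝ) = B
  simp only [Pi.mul_apply]
  linear_combination (-t * A) * o1 + (t ^ 2 * B) * o2

lemma entireProfile_of_neg (a : ℝ) {t : ℝ} (ht : t < 0) :
    entireProfile a t = tricomiReal a (2 / 3) (-t ^ 3 / 9) := by
  have h := cube_div_nine_rpow_third (u := -t) (by linarith)
  rw [show (-t) ^ 3 / 9 = -t ^ 3 / 9 by ring] at h
  rw [entireProfile, tricomiReal, h]
  ring

/-- On the positive half-line `entireProfile a` is recessive. -/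
lemma entireProfile_of_pos {a t : ℝ} (ht : 0 < t) (hΓ : Real.Gamma a ≠ 0)
    (hΓ1 : Real.Gamma (a - 2 / 3 + 1) ≠ 0) (hΓ2 : Real.Gamma (1 - a) ≠ 0)
    (hΓ3 : Real.Gamma (2 / 3 - a) ≠ 0)
    (hsin : Real.sin (π * (a - 2 / 3 + 1)) = -Real.sin (π * a)) :
    entireProfile a t = Real.Gamma (1 - a) / Real.Gamma (a - 2 / 3 + 1) *
      (Real.exp (-(t ^ 3 / 9)) * tricomiReal (2 / 3 - a) (2 / 3) (t ^ 3 / 9)) := by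
  have hs : 0 < t ^ 3 / 9 := by positivity
  -- Reflection and the sine hypothesis give Γ(a)Γ(1-a) = -Γ(a+1/3)Γ(2/3-a). This makes the ratio of
  -- the two coefficients equal to that in U(2/3-a,2/3,·), so the growing solution drops out.
  have r1 := Real.Gamma_mul_Gamma_one_sub a
  have r2 := Real.Gamma_mul_Gamma_one_sub (a - 2 / 3 + 1)
  rw [show 1 - (a - 2 / 3 + 1) = 2 / 3 - a by ring, hsin, div_neg, ← r1] at r2
  rw [entireProfile, tricomiReal, cube_div_nine_rpow_third ht.le, neg_div,
    kummerReal_neg (by norm_num) (by norm_num) a hs,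
    kummerReal_two_sub_neg (by norm_num) (by norm_num) a hs,
    show 2 / 3 - a - 2 / 3 + 1 = 1 - a by ring]
  generalize kummerReal (2 / 3 - a) (2 / 3) (t ^ 3 / 9) = M
  generalize kummerReal (1 - a) (2 - 2 / 3) (t ^ 3 / 9) = N
  generalize (9 : ℝ) ^ (-(1 / 3) : ℝ) = κ
  generalize Real.exp (-(t ^ 3 / 9)) = E
  generalize Real.Gamma (2 / 3 - 1) = G
  generalize Real.Gamma (1 - 2 / 3) = G'
  generalize Real.Gamma (a - 2 / 3 + 1) = g1 at *
  generalize Real.Gamma (1 - a) = g2 at *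
  generalize Real.Gamma (2 / 3 - a) = g3 at *
  generalize Real.Gamma a = g at *
  field_simp
  linear_combination (-G * κ * t * N * E) * r2

lemma tricomiU_ofReal (a s : ℝ) :
    tricomiU a (2 / 3) s = Real.Gamma (1 - 2 / 3) * (Real.Gamma (a - 2 / 3 + 1))⁻¹ *
        kummerReal a (2 / 3) s
      + (Real.Gamma (2 / 3 - 1) * (Real.Gamma a)⁻¹ * kummerReal (a - 2 / 3 + 1) (2 - 2 / 3) s : ℝ)
        * (s : ℂ) ^ (1 / 3 : ℂ) := by
  have hb : ¬ ∃ n : ℤ, (2 / 3 : ℂ) = n := by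
    rintro ⟨n, hn⟩
    have h : (2 : ℂ) = ((3 * n : ℤ) : ℂ) := by push_cast; rw [← hn]; norm_num
    have h' : (2 : ℤ) = 3 * n := by exact_mod_cast h
    omega
  have h23 : (2 / 3 : ℂ) = ((2 / 3 : ℝ) : ℂ) := by push_cast; rfl
  have e1 : (1 : ℂ) - ((2 / 3 : ℝ) : ℂ) = ((1 - 2 / 3 : ℝ) : ℂ) := by push_cast; rfl
  have e2 : (a : ℂ) - ((2 / 3 : ℝ) : ℂ) + 1 = ((a - 2 / 3 + 1 : ℝ) : ℂ) := by push_cast; rfl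
  have e3 : ((2 / 3 : ℝ) : ℂ) - 1 = ((2 / 3 - 1 : ℝ) : ℂ) := by push_cast; rfl
  have e4 : (2 : ℂ) - ((2 / 3 : ℝ) : ℂ) = ((2 - 2 / 3 : ℝ) : ℂ) := by push_cast; rfl
  have e5 : (1 / 3 : ℂ) = ((1 - 2 / 3 : ℝ) : ℂ) := by push_cast; norm_num
  rw [tricomiU, if_neg hb, tricomiCombination, h23, e1, e2, e3, e4, e5, Complex.Gamma_ofReal,
    Complex.Gamma_ofReal, Complex.Gamma_ofReal, Complex.Gamma_ofReal, kummerM_ofReal,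
    kummerM_ofReal]
  push_cast
  ring

/-- For t < 0 only Re e^{iπ/3} = 1/2 enters. For t > 0 the principal cube root of a negative number
contributes a second e^{iπ/3}, and Re e^{2iπ/3} = -1/2 produces the sign under which |t| continues
analytically as -t. -/
lemma re_exp_mul_tricomiU (a t : ℝ) :
    (Complex.exp (Complex.I * (π / 3 : ℝ)) * tricomiU a (2 / 3) ((-t ^ 3 / 9 : ℝ) : ℂ)).re
      = entireProfile a t / 2 := by
  have hc : Complex.exp (Complex.I * (π / 3 : ℝ))
      = ((1 / 2 : ℝ) : ℂ) + ((√3 / 2 : ℝ) : ℂ) * Complex.I := by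
    rw [mul_comm, Complex.exp_mul_I, ← Complex.ofReal_cos, ← Complex.ofReal_sin,
      Real.cos_pi_div_three, Real.sin_pi_div_three]
  have h3 : √3 * √3 = 3 := Real.mul_self_sqrt (by norm_num)
  have e5 : (1 / 3 : ℂ) = ((1 - 2 / 3 : ℝ) : ℂ) := by push_cast; norm_num
  rw [tricomiU_ofReal, hc, entireProfile]
  rcases lt_or_ge t 0 with ht | ht
  · have hp : ((-t ^ 3 / 9 : ℝ) : ℂ) ^ (1 / 3 : ℂ) = (((9 : ℝ) ^ (-(1 / 3) : ℝ) * -t : ℝ) : ℂ) := by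
      rw [← cube_div_nine_rpow_third (u := -t) (by linarith), e5, ← Complex.ofReal_cpow]
      · congr 3; ring
      · have := pow_pos (neg_pos.2 ht) 3
        nlinarith
    rw [hp]
    simp only [← Complex.ofReal_mul, ← Complex.ofReal_add, Complex.mul_re,
      Complex.add_re, Complex.add_im, Complex.mul_im, Complex.ofReal_re, Complex.ofReal_im,
      Complex.I_re, Complex.I_im]
    ring
  · have hp : ((-t ^ 3 / 9 : ℝ) : ℂ) ^ (1 / 3 : ℂ)
        = (((9 : ℝ) ^ (-(1 / 3) : ℝ) * t : ℝ) : ℂ) *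
          (((1 / 2 : ℝ) : ℂ) + ((√3 / 2 : ℝ) : ℂ) * Complex.I) := by
      have hx : -t ^ 3 / 9 ≤ 0 := by
        have := pow_nonneg ht 3
        linarith
      rw [Complex.ofReal_cpow_of_nonpos hx, ← hc, ← cube_div_nine_rpow_third ht, e5,
        Complex.ofReal_cpow (by positivity)]
      congr 2
      · push_cast; ring
      · push_cast; ring
    rw [hp]
    simp only [← Complex.ofReal_mul, Complex.mul_re,
      Complex.add_re, Complex.add_im, Complex.mul_im, Complex.ofReal_re, Complex.ofReal_im,
      Complex.I_re, Complex.I_im]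
    linear_combination (-(Real.Gamma (2 / 3 - 1) * (Real.Gamma a)⁻¹ *
      kummerReal (a - 2 / 3 + 1) (2 - 2 / 3) (-t ^ 3 / 9) * ((9 : ℝ) ^ (-(1 / 3) : ℝ) * t)) / 4)
      * h3

lemma angularProfile_eq (k : ℤ) (t : ℝ) :
    angularProfile k t = (9 : ℝ) ^ (1 / 6 + (k : ℝ)) * (1 + t ^ 2) ^ (-(singExponent k) / 2) *
      entireProfile (-(singExponent k) / 3) t := by
  rw [angularProfile, re_exp_mul_tricomiU]
  ring

lemma contDiff_angularProfile (k : ℤ) : ContDiff ℝ ∞ (angularProfile k) := by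
  rw [funext (angularProfile_eq k)]
  refine ContDiff.mul (contDiff_const.mul ?_) (contDiff_entireProfile _)
  refine contDiff_iff_contDiffAt.2 fun t => ContDiffAt.rpow_const_of_ne (by fun_prop) ?_
  positivity

/-! ### The solution near the line x = 0 -/

/-- With `q = 9x/|z|³`, the ratio `v_k(x,z) / |z|^λ` for `z < 0`. -/
def leftProfile (a q : ℝ) : ℝ := if 0 < q then q⁻¹ ^ a * tricomiReal a (2 / 3) q⁻¹ else 1

/-- With `q = 9x/z³`, the ratio `v_k(x,z) / z^λ` for `z > 0`. -/
def rightProfile (a q : ℝ) : ℝ :=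
  if 0 < q then Real.Gamma (1 - a) / Real.Gamma (a - 2 / 3 + 1) *
    (q⁻¹ ^ a * (Real.exp (-q⁻¹) * tricomiReal (2 / 3 - a) (2 / 3) q⁻¹)) else 0

/-- With q = 1/s the difference quotient at q = 0 is s·(g(s) - h(0)), so the second coefficient of
an expansion at infinity is a one-sided derivative at 0. -/
lemma hasDerivWithinAt_Ici_zero_of_tendsto {h g : ℝ → ℝ} {L : ℝ}
    (hg : ∀ q, 0 < q → h q = g q⁻¹)
    (hT : Tendsto (fun s => s * (g s - h 0)) atTop (𝓝 L)) :
    HasDerivWithinAt h L (Ici 0) 0 := by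
  rw [hasDerivWithinAt_iff_tendsto_slope, Ici_sdiff_left]
  refine (hT.comp tendsto_inv_nhdsGT_zero).congr' ?_
  filter_upwards [self_mem_nhdsWithin] with q (hq : 0 < q)
  simp only [Function.comp_apply, slope_def_field, hg q hq, sub_zero]
  ring

lemma hasDerivWithinAt_leftProfile (a : ℝ) :
    HasDerivWithinAt (leftProfile a) (-(a * (a - 2 / 3 + 1))) (Ici 0) 0 := by
  refine hasDerivWithinAt_Ici_zero_of_tendsto
    (g := fun s => s ^ a * tricomiReal a (2 / 3) s) (fun q hq => by simp [leftProfile, hq]) ?_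
  have h := tendsto_mul_rpow_mul_tricomiReal_sub_one (b := 2 / 3) (by norm_num) (by norm_num) a
  simpa [leftProfile] using h

lemma hasDerivWithinAt_rightProfile (a : ℝ) :
    HasDerivWithinAt (rightProfile a) 0 (Ici 0) 0 := by
  refine hasDerivWithinAt_Ici_zero_of_tendsto
    (g := fun s => Real.Gamma (1 - a) / Real.Gamma (a - 2 / 3 + 1) *
      (s ^ a * (Real.exp (-s) * tricomiReal (2 / 3 - a) (2 / 3) s)))
    (fun q hq => by simp [rightProfile, hq]) ?_
  have h := (tendsto_mul_rpow_mul_exp_mul_tricomiReal (b := 2 / 3) (by norm_num) (by norm_num)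
    (2 / 3 - a) a).const_mul (Real.Gamma (1 - a) / Real.Gamma (a - 2 / 3 + 1))
  rw [mul_zero] at h
  refine h.congr fun s => ?_
  simp only [rightProfile, lt_irrefl, if_false]
  ring

/-- Since r² = x^{2/3}(1+t²), the powers of r and of 1+t² combine to x^{λ/3}. -/
lemma singularSolution_of_pos (k : ℤ) {x : ℝ} (hx : 0 < x) (z : ℝ) :
    singularSolution k x z = (9 : ℝ) ^ (1 / 6 + (k : ℝ)) * (x ^ (singExponent k / 3) *
      entireProfile (-(singExponent k) / 3) (z * x ^ (-(1 / 3) : ℝ))) := by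
  rw [singularSolution, if_pos hx, angularProfile_eq, radialVar, angularVar]
  set l := singExponent k
  have hx1 : 0 < x ^ (2 / 3 : ℝ) := Real.rpow_pos_of_pos hx _
  have hR : 0 < z ^ 2 + x ^ (2 / 3 : ℝ) := by positivity
  have e1 : 1 + (z * x ^ (-(1 / 3) : ℝ)) ^ 2 = (z ^ 2 + x ^ (2 / 3 : ℝ)) / x ^ (2 / 3 : ℝ) := by
    have : (x ^ (-(1 / 3) : ℝ)) ^ 2 = (x ^ (2 / 3 : ℝ))⁻¹ := by
      rw [← Real.rpow_natCast, ← Real.rpow_mul hx.le, ← Real.rpow_neg hx.le]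
      norm_num
    rw [mul_pow, this]
    field_simp
    ring
  have e2 : ((z ^ 2 + x ^ (2 / 3 : ℝ)) ^ (1 / 2 : ℝ)) ^ l
      * ((z ^ 2 + x ^ (2 / 3 : ℝ)) / x ^ (2 / 3 : ℝ)) ^ (-l / 2) = x ^ (l / 3) := by
    rw [← Real.rpow_mul hR.le, Real.div_rpow hR.le hx1.le, ← Real.rpow_mul hx.le,
      show 2 / 3 * (-l / 2) = -(l / 3) by ring, Real.rpow_neg hx.le, div_inv_eq_mul, ← mul_assoc,
      ← Real.rpow_add hR, show 1 / 2 * l + -l / 2 = 0 by ring, Real.rpow_zero, one_mul]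
  rw [e1, ← e2]
  ring

lemma rpow_neg_third_cube {x : ℝ} (hx : 0 < x) : (x ^ (-(1 / 3) : ℝ)) ^ 3 = x⁻¹ := by
  rw [← Real.rpow_natCast, ← Real.rpow_mul hx.le, ← Real.rpow_neg_one]
  norm_num

/-- The normalising constant is 9^{λ/3}; it makes the boundary value for z < 0 exactly |z|^λ. -/
lemma nine_rpow_mul_rpow (k : ℤ) {x u : ℝ} (hx : 0 < x) (hu : 0 < u) :
    (9 : ℝ) ^ (1 / 6 + (k : ℝ)) * x ^ (singExponent k / 3)
      = u ^ singExponent k * (9 * x / u ^ 3)⁻¹ ^ (-(singExponent k) / 3) := by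
  have e : (1 / 6 + (k : ℝ)) = singExponent k / 3 := by rw [singExponent]; ring
  have e1 : u ^ singExponent k = (u ^ 3) ^ (singExponent k / 3) := by
    rw [← Real.rpow_natCast, ← Real.rpow_mul hu.le]
    congr 1
    push_cast
    ring
  rw [e, ← Real.mul_rpow (by norm_num) hx.le, Real.inv_rpow (by positivity), neg_div,
    Real.rpow_neg (by positivity), inv_inv, e1, ← Real.mul_rpow (by positivity) (by positivity)]
  congr 1
  field_simp

lemma radialVar_zero_of_neg {z : ℝ} (hz : z < 0) : radialVar 0 z = -z := by
  rw [radialVar, Real.zero_rpow (by norm_num), add_zero, ← Real.sqrt_eq_rpow,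
    Real.sqrt_sq_eq_abs, abs_of_neg hz]

lemma singularSolution_of_neg (k : ℤ) {x z : ℝ} (hx : 0 ≤ x) (hz : z < 0) :
    singularSolution k x z
      = (-z) ^ singExponent k * leftProfile (-(singExponent k) / 3) (9 * x / (-z) ^ 3) := by
  have hz' : 0 < -z := by linarith
  rcases hx.eq_or_lt with rfl | hx
  · simp [singularSolution, hz, leftProfile, radialVar_zero_of_neg hz]
  · have hxp : 0 < x ^ (-(1 / 3) : ℝ) := Real.rpow_pos_of_pos hx _
    have hq : 0 < 9 * x / (-z) ^ 3 := by positivity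
    have e : -(z * x ^ (-(1 / 3) : ℝ)) ^ 3 / 9 = (9 * x / (-z) ^ 3)⁻¹ := by
      rw [mul_pow, rpow_neg_third_cube hx]
      field_simp
    rw [singularSolution_of_pos k hx, entireProfile_of_neg _ (mul_neg_of_neg_of_pos hz hxp), e,
      leftProfile, if_pos hq, ← mul_assoc, nine_rpow_mul_rpow k hx hz', mul_assoc]

lemma Gamma_ne_zero_of_six_mul {a : ℝ} {n : ℤ} (ha : 6 * a = n) (hn : ¬ (6 : ℤ) ∣ n) :
    Real.Gamma a ≠ 0 := by
  refine Real.Gamma_ne_zero fun m hm => hn ⟨-m, ?_⟩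
  have : (n : ℝ) = ((6 * -m : ℤ) : ℝ) := by
    rw [← ha, hm]
    push_cast
    ring
  exact_mod_cast this

/-- Here the choice of λ enters: a = -1/6 - k and a + 1/3 = 1/6 - k, so the sines at πa and π(a+1/3)
are opposite. The four Γ arguments are ±1/6 modulo 1, hence none is a pole. -/
lemma entireProfile_singExponent_of_pos (k : ℤ) {t : ℝ} (ht : 0 < t) :
    entireProfile (-(singExponent k) / 3) t
      = Real.Gamma (1 - -(singExponent k) / 3) / Real.Gamma (-(singExponent k) / 3 - 2 / 3 + 1) *
      (Real.exp (-(t ^ 3 / 9)) *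
        tricomiReal (2 / 3 - -(singExponent k) / 3) (2 / 3) (t ^ 3 / 9)) := by
  refine entireProfile_of_pos ht
    (Gamma_ne_zero_of_six_mul (n := -1 - 6 * k) (by rw [singExponent]; push_cast; ring) (by omega))
    (Gamma_ne_zero_of_six_mul (n := 1 - 6 * k) (by rw [singExponent]; push_cast; ring) (by omega))
    (Gamma_ne_zero_of_six_mul (n := 7 + 6 * k) (by rw [singExponent]; push_cast; ring) (by omega))
    (Gamma_ne_zero_of_six_mul (n := 5 + 6 * k) (by rw [singExponent]; push_cast; ring) (by omega))
    ?_
  have e1 : π * (-(singExponent k) / 3 - 2 / 3 + 1) = π / 6 - k * π := by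
    rw [singExponent]; ring
  have e2 : π * (-(singExponent k) / 3) = -(π / 6) - k * π := by
    rw [singExponent]; ring
  rw [e1, e2, Real.sin_sub_int_mul_pi, Real.sin_sub_int_mul_pi, Real.sin_neg]
  ring

lemma singularSolution_of_pos' (k : ℤ) {x z : ℝ} (hx : 0 ≤ x) (hz : 0 < z) :
    singularSolution k x z
      = z ^ singExponent k * rightProfile (-(singExponent k) / 3) (9 * x / z ^ 3) := by
  rcases hx.eq_or_lt with rfl | hx
  · simp [singularSolution, hz.le, rightProfile]
  · have hxp : 0 < x ^ (-(1 / 3) : ℝ) := Real.rpow_pos_of_pos hx _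
    have hq : 0 < 9 * x / z ^ 3 := by positivity
    have e : (z * x ^ (-(1 / 3) : ℝ)) ^ 3 / 9 = (9 * x / z ^ 3)⁻¹ := by
      rw [mul_pow, rpow_neg_third_cube hx]
      field_simp
    rw [singularSolution_of_pos k hx, entireProfile_singExponent_of_pos k (mul_pos hz hxp), e,
      rightProfile, if_pos hq, ← mul_assoc, nine_rpow_mul_rpow k hx hz]
    ring

/-! ### Regularity and the equation on the punctured half-plane -/

lemma contDiffOn_singularSolution (k : ℤ) :
    ContDiffOn ℝ 2 (fun p : ℝ × ℝ => singularSolution k p.1 p.2) {p | 0 < p.1} := by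
  refine ContDiffOn.congr (f := fun p : ℝ × ℝ => (9 : ℝ) ^ (1 / 6 + (k : ℝ)) *
    (p.1 ^ (singExponent k / 3) *
      entireProfile (-(singExponent k) / 3) (p.2 * p.1 ^ (-(1 / 3) : ℝ)))) ?_
    fun p hp => singularSolution_of_pos k hp p.2
  have h1 : ∀ e : ℝ, ContDiffOn ℝ 2 (fun p : ℝ × ℝ => p.1 ^ e) {p | 0 < p.1} := fun e =>
    contDiff_fst.contDiffOn.rpow_const_of_ne fun p hp => ne_of_gt hp
  have h2 : ContDiff ℝ 2 (entireProfile (-(singExponent k) / 3)) :=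
    contDiff_infty.1 (contDiff_entireProfile _) 2
  exact contDiffOn_const.mul ((h1 _).mul
    (h2.comp_contDiffOn (contDiff_snd.contDiffOn.mul (h1 _))))

lemma continuousWithinAt_of_eq_mul_profile {u : ℝ × ℝ → ℝ} {f φ h : ℝ → ℝ} {S : Set (ℝ × ℝ)}
    {z : ℝ} (hu : ∀ᶠ p in 𝓝[S] (0, z), u p = f p.2 * h (9 * p.1 / φ p.2))
    (hu0 : u (0, z) = f z * h 0) (hS : ∀ᶠ p in 𝓝[S] (0, z), 0 ≤ 9 * p.1 / φ p.2)
    (hf : ContinuousAt f z) (hφ : ContinuousAt φ z) (hφ0 : φ z ≠ 0)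
    (hh : ContinuousWithinAt h (Ici 0) 0) : ContinuousWithinAt u S (0, z) := by
  have t1 : Tendsto (fun p : ℝ × ℝ => 9 * p.1 / φ p.2) (𝓝[S] (0, z)) (𝓝[Ici 0] 0) := by
    refine tendsto_nhdsWithin_iff.2 ⟨?_, hS⟩
    have c1 : ContinuousAt (fun p : ℝ × ℝ => 9 * p.1 / φ p.2) (0, z) :=
      ContinuousAt.div (by fun_prop) (ContinuousAt.comp (x := ((0 : ℝ), z)) hφ continuousAt_snd)
        hφ0
    simpa using c1.tendsto.mono_left nhdsWithin_le_nhds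
  have t2 : Tendsto (fun p : ℝ × ℝ => f p.2) (𝓝[S] (0, z)) (𝓝 (f z)) :=
    (ContinuousAt.comp (x := ((0 : ℝ), z)) hf continuousAt_snd).tendsto.mono_left
      nhdsWithin_le_nhds
  rw [ContinuousWithinAt, hu0]
  refine (t2.mul (hh.tendsto.comp t1)).congr' ?_
  filter_upwards [hu] with p hp using hp.symm

lemma continuousOn_singularSolution (k : ℤ) :
    ContinuousOn (fun p : ℝ × ℝ => singularSolution k p.1 p.2) puncturedHalfPlane := by
  rintro ⟨x, z⟩ ⟨hx : 0 ≤ x, hxz⟩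
  rcases hx.eq_or_lt with rfl | hx
  · have hS : ∀ᶠ p : ℝ × ℝ in 𝓝[puncturedHalfPlane] (0, z), 0 ≤ p.1 := by
      filter_upwards [self_mem_nhdsWithin] with p hp using hp.1
    have hz : z ≠ 0 := fun h => hxz (by rw [h])
    rcases hz.lt_or_gt with hz | hz
    · have hev : ∀ᶠ p : ℝ × ℝ in 𝓝[puncturedHalfPlane] (0, z), p.2 < 0 :=
        nhdsWithin_le_nhds (continuousAt_snd.eventually_lt_const hz)
      refine continuousWithinAt_of_eq_mul_profile (f := fun z => (-z) ^ singExponent k)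
        (φ := fun z => (-z) ^ 3) (h := leftProfile (-(singExponent k) / 3)) ?_ ?_ ?_ ?_
        (by fun_prop) (pow_pos (neg_pos.2 hz) 3).ne'
        (hasDerivWithinAt_leftProfile _).continuousWithinAt
      · filter_upwards [hev, hS] with p h1 h2 using singularSolution_of_neg k h2 h1
      · simpa using singularSolution_of_neg k le_rfl hz
      · filter_upwards [hev, hS] with p h1 h2
        have := pow_pos (neg_pos.2 h1) 3
        positivity
      · exact ContinuousAt.rpow_const (by fun_prop) (Or.inl (by linarith))
    · have hev : ∀ᶠ p : ℝ × ℝ in 𝓝[puncturedHalfPlane] (0, z), 0 < p.2 :=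
        nhdsWithin_le_nhds (continuousAt_snd.eventually_const_lt hz)
      refine continuousWithinAt_of_eq_mul_profile (f := fun z => z ^ singExponent k)
        (φ := fun z => z ^ 3) (h := rightProfile (-(singExponent k) / 3)) ?_ ?_ ?_ ?_
        (by fun_prop) (pow_pos hz 3).ne'
        (hasDerivWithinAt_rightProfile _).continuousWithinAt
      · filter_upwards [hev, hS] with p h1 h2 using singularSolution_of_pos' k h2 h1
      · simpa using singularSolution_of_pos' k le_rfl hz
      · filter_upwards [hev, hS] with p h1 h2
        positivity
      · exact ContinuousAt.rpow_const (by fun_prop) (Or.inl hz.ne')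
  · have ho : IsOpen {p : ℝ × ℝ | 0 < p.1} := isOpen_lt continuous_const continuous_fst
    exact ((contDiffOn_singularSolution k).continuousOn.continuousAt
      (ho.mem_nhds hx)).continuousWithinAt

/-- The equation `z u_x = u_zz` at the point `(x,z)`, together with the existence of the
derivatives occurring in it. -/
def SolvesAt (u : ℝ → ℝ → ℝ) (x z : ℝ) : Prop :=
  ∃ (d d₂ : ℝ) (g : ℝ → ℝ), HasDerivWithinAt (fun s => u s z) d (Ici 0) x ∧
    (∀ᶠ y in 𝓝 z, HasDerivAt (fun y => u x y) (g y) y) ∧ HasDerivAt g d₂ z ∧ z * d - d₂ = 0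

lemma solvesAt_singularSolution_of_pos (k : ℤ) {x : ℝ} (hx : 0 < x) (z : ℝ) :
    SolvesAt (singularSolution k) x z := by
  set l := singExponent k with hl
  set a := -l / 3 with ha
  set κ := (9 : ℝ) ^ (1 / 6 + (k : ℝ)) with hκ
  have hdt : ∀ y, HasDerivAt (fun y : ℝ => y * x ^ (-(1 / 3) : ℝ)) (x ^ (-(1 / 3) : ℝ)) y :=
    fun y => by simpa using (hasDerivAt_id y).mul_const (x ^ (-(1 / 3) : ℝ))
  have h1 := Real.hasDerivAt_rpow_const (p := l / 3) (Or.inl hx.ne')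
  have h2 := (Real.hasDerivAt_rpow_const (x := x) (p := -(1 / 3)) (Or.inl hx.ne')).const_mul z
  have h3 := (h1.mul ((hasDerivAt_entireProfile a _).comp x h2)).const_mul κ
  have h4 : (fun s => singularSolution k s z) =ᶠ[𝓝 x] fun s => κ * (s ^ (l / 3) *
      entireProfile a (z * s ^ (-(1 / 3) : ℝ))) := by
    filter_upwards [lt_mem_nhds hx] with s hs using singularSolution_of_pos k hs z
  refine ⟨_, _, fun y => κ * (x ^ (l / 3) * (entireProfileDeriv a (y * x ^ (-(1 / 3) : ℝ)) *
    x ^ (-(1 / 3) : ℝ))), (h3.congr_of_eventuallyEq h4).hasDerivWithinAt,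
    Eventually.of_forall fun y => ?_, (((((hasDerivAt_entireProfileDeriv a _).comp z
      (hdt z)).mul_const (x ^ (-(1 / 3) : ℝ))).const_mul _).const_mul _), ?_⟩
  · rw [funext fun y => singularSolution_of_pos k hx y]
    exact (((hasDerivAt_entireProfile a _).comp y (hdt y)).const_mul _).const_mul _
  -- All powers of x reduce to x^{l/3} times powers of w = x^{-1/3}. With t = zw the second-order
  -- equation for the profile then cancels z·u_x against u_zz.
  · have e1 : x ^ (l / 3 - 1) = x ^ (l / 3) * (x ^ (-(1 / 3) : ℝ)) ^ 3 := by
      rw [rpow_neg_third_cube hx, Real.rpow_sub hx, Real.rpow_one, div_eq_mul_inv]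
    have e2 : x ^ (-(1 / 3) - 1 : ℝ) = x ^ (-(1 / 3) : ℝ) * (x ^ (-(1 / 3) : ℝ)) ^ 3 := by
      rw [rpow_neg_third_cube hx, Real.rpow_sub hx, Real.rpow_one, div_eq_mul_inv]
    simp only [Function.comp_apply]
    rw [e1, e2, ha]
    ring

/-- The x-derivative is |z|^λ·(9/|z|³)·(-a(a+1/3)); multiplied by z = -|z| it equals
λ(λ-1)|z|^{λ-2}, the second derivative of |z|^λ. -/
lemma solvesAt_singularSolution_zero_of_neg (k : ℤ) {z : ℝ} (hz : z < 0) :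
    SolvesAt (singularSolution k) 0 z := by
  set l := singExponent k with hl
  have hz' : 0 < -z := by linarith
  have h0 : HasDerivWithinAt (fun s : ℝ => 9 * s / (-z) ^ 3) (9 * 1 / (-z) ^ 3) (Ici 0) 0 :=
    (((hasDerivAt_id (0 : ℝ)).const_mul 9).div_const ((-z) ^ 3)).hasDerivWithinAt
  have h1 := (HasDerivWithinAt.comp_of_eq (0 : ℝ) (hasDerivWithinAt_leftProfile (-l / 3)) h0
    (fun s (hs : 0 ≤ s) => by simp only [mem_Ici]; positivity) (by simp)).const_mul ((-z) ^ l)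
  have hneg : ∀ y : ℝ, HasDerivAt (fun y : ℝ => -y) (-1) y := fun y => (hasDerivAt_id y).neg
  have h2 : ∀ p y : ℝ, y < 0 → HasDerivAt (fun y : ℝ => (-y) ^ p) (-1 * p * (-y) ^ (p - 1)) y :=
    fun p y hy => (hneg y).rpow_const (Or.inl (by linarith))
  refine ⟨_, _, fun y => -1 * l * (-y) ^ (l - 1), h1.congr (fun s hs => ?_) ?_, ?_,
    (h2 (l - 1) z hz).const_mul _, ?_⟩
  · exact singularSolution_of_neg k hs hz
  · exact singularSolution_of_neg k le_rfl hz
  · filter_upwards [gt_mem_nhds hz] with y hy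
    refine (h2 l y hy).congr_of_eventuallyEq ?_
    filter_upwards [gt_mem_nhds hy] with w hw
    rw [singularSolution_of_neg k le_rfl hw]
    simp [leftProfile, hl]
  · have e : (-z) ^ l = (-z) ^ (l - 1 - 1) * (-z) ^ 2 := by
      rw [← Real.rpow_natCast, ← Real.rpow_add hz']
      congr 1
      push_cast
      ring
    have hz0 : z ≠ 0 := hz.ne
    rw [e]
    field_simp
    ring

/-- Exponential decay in 1/q makes the x-derivative vanish, and u is identically 0 on this
half-line. -/
lemma solvesAt_singularSolution_zero_of_pos (k : ℤ) {z : ℝ} (hz : 0 < z) :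
    SolvesAt (singularSolution k) 0 z := by
  set l := singExponent k with hl
  have h0 : HasDerivWithinAt (fun s : ℝ => 9 * s / z ^ 3) (9 * 1 / z ^ 3) (Ici 0) 0 :=
    (((hasDerivAt_id (0 : ℝ)).const_mul 9).div_const (z ^ 3)).hasDerivWithinAt
  have h1 := (HasDerivWithinAt.comp_of_eq (0 : ℝ) (hasDerivWithinAt_rightProfile (-l / 3)) h0
    (fun s (hs : 0 ≤ s) => by simp only [mem_Ici]; positivity) (by simp)).const_mul (z ^ l)
  refine ⟨_, 0, fun _ => 0, h1.congr (fun s hs => ?_) ?_, ?_, hasDerivAt_const _ _, by simp⟩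
  · exact singularSolution_of_pos' k hs hz
  · exact singularSolution_of_pos' k le_rfl hz
  · filter_upwards [lt_mem_nhds hz] with y hy
    refine (hasDerivAt_const y (0 : ℝ)).congr_of_eventuallyEq ?_
    filter_upwards [lt_mem_nhds hy] with w hw
    simp [singularSolution, hw.le]

lemma solvesAt_singularSolution (k : ℤ) {x z : ℝ} (h : (x, z) ∈ puncturedHalfPlane) :
    SolvesAt (singularSolution k) x z := by
  obtain ⟨hx : 0 ≤ x, hxz⟩ := h
  rcases hx.eq_or_lt with rfl | hx
  · have hz : z ≠ 0 := fun h => hxz (by rw [h])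
    rcases hz.lt_or_gt with hz | hz
    · exact solvesAt_singularSolution_zero_of_neg k hz
    · exact solvesAt_singularSolution_zero_of_pos k hz
  · exact solvesAt_singularSolution_of_pos k hx z

lemma isHalfPlaneSolution_singularSolution (k : ℤ) :
    IsHalfPlaneSolution (singularSolution k) where
  continuousOn := continuousOn_singularSolution k
  contDiffOn := contDiffOn_singularSolution k
  differentiable_x x z h := by
    obtain ⟨d, d₂, g, h1, -⟩ := solvesAt_singularSolution k h
    exact h1.differentiableWithinAt
  differentiable_z x z h := by
    obtain ⟨d, d₂, g, -, h2, -⟩ := solvesAt_singularSolution k h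
    exact h2.self_of_nhds.differentiableAt
  differentiable_zz x z h := by
    obtain ⟨d, d₂, g, -, h2, h3, -⟩ := solvesAt_singularSolution k h
    exact (h3.congr_of_eventuallyEq (h2.mono fun y hy => hy.deriv)).differentiableAt
  equation x z h := by
    obtain ⟨d, d₂, g, h1, h2, h3, h4⟩ := solvesAt_singularSolution k h
    rw [h1.derivWithin (uniqueDiffOn_Ici 0 x h.1),
      (h3.congr_of_eventuallyEq (h2.mono fun y hy => hy.deriv)).deriv, h4]
  boundary z hz := by simp [singularSolution, hz.le]

/-! ### Limits and boundedness of the angular profile -/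

/-- The chosen point is the one with r = 1 and angular variable t; as t → ±∞ it tends to (0, ±1). -/
lemma angularProfile_eq_singularSolution (k : ℤ) (t : ℝ) :
    angularProfile k t = singularSolution k ((1 + t ^ 2) ^ (-(3 / 2) : ℝ))
      (t * (1 + t ^ 2) ^ (-(1 / 2) : ℝ)) := by
  have hT : 0 < 1 + t ^ 2 := by positivity
  have e1 : ((1 + t ^ 2) ^ (-(3 / 2) : ℝ)) ^ (2 / 3 : ℝ) = (1 + t ^ 2)⁻¹ := by
    rw [← Real.rpow_mul hT.le, ← Real.rpow_neg_one]; norm_num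
  have e2 : ((1 + t ^ 2) ^ (-(3 / 2) : ℝ)) ^ (-(1 / 3) : ℝ) = (1 + t ^ 2) ^ (1 / 2 : ℝ) := by
    rw [← Real.rpow_mul hT.le]; norm_num
  have e3 : ((1 + t ^ 2) ^ (-(1 / 2) : ℝ)) ^ 2 = (1 + t ^ 2)⁻¹ := by
    rw [← Real.rpow_natCast, ← Real.rpow_mul hT.le, ← Real.rpow_neg_one]; norm_num
  have e4 : (1 + t ^ 2) ^ (-(1 / 2) : ℝ) * (1 + t ^ 2) ^ (1 / 2 : ℝ) = 1 := by
    rw [← Real.rpow_add hT]; norm_num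
  have hr : radialVar ((1 + t ^ 2) ^ (-(3 / 2) : ℝ)) (t * (1 + t ^ 2) ^ (-(1 / 2) : ℝ)) = 1 := by
    rw [radialVar, e1, mul_pow, e3, show t ^ 2 * (1 + t ^ 2)⁻¹ + (1 + t ^ 2)⁻¹ = 1 by
      field_simp; ring, Real.one_rpow]
  rw [singularSolution, if_pos (Real.rpow_pos_of_pos hT _), hr, Real.one_rpow, one_mul,
    angularVar, e2, mul_assoc, e4, mul_one]

/-- The hypotheses are met with σ = ±1, the sign of t along the filter; this treats both ends at
once. On r = 1 one has |z| = √(1 - 1/(1+t²)), which tends to 1. -/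
lemma tendsto_angularProfile (k : ℤ) {l : Filter ℝ} {σ : ℝ} (hσ : σ ≠ 0)
    (hl : Tendsto (fun t : ℝ => t ^ 2) l atTop)
    (hs : ∀ᶠ t : ℝ in l, t * (1 + t ^ 2) ^ (-(1 / 2) : ℝ)
      = σ * |t * (1 + t ^ 2) ^ (-(1 / 2) : ℝ)|) :
    Tendsto (angularProfile k) l (𝓝 (singularSolution k 0 σ)) := by
  have hT : Tendsto (fun t : ℝ => 1 + t ^ 2) l atTop := tendsto_atTop_add_const_left _ _ hl
  have hx : Tendsto (fun t : ℝ => (1 + t ^ 2) ^ (-(3 / 2) : ℝ)) l (𝓝 0) :=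
    (tendsto_rpow_neg_atTop (by norm_num)).comp hT
  have hz : Tendsto (fun t : ℝ => t * (1 + t ^ 2) ^ (-(1 / 2) : ℝ)) l (𝓝 σ) := by
    have h1 : Tendsto (fun t : ℝ => σ * √(1 - (1 + t ^ 2)⁻¹)) l (𝓝 (σ * √(1 - 0))) :=
      ((Real.continuous_sqrt.tendsto _).comp
        (tendsto_const_nhds.sub (tendsto_inv_atTop_zero.comp hT))).const_mul σ
    rw [sub_zero, Real.sqrt_one, mul_one] at h1
    refine h1.congr' ?_
    filter_upwards [hs] with t ht
    have hT : 0 < 1 + t ^ 2 := by positivity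
    have e3 : ((1 + t ^ 2) ^ (-(1 / 2) : ℝ)) ^ 2 = (1 + t ^ 2)⁻¹ := by
      rw [← Real.rpow_natCast, ← Real.rpow_mul hT.le, ← Real.rpow_neg_one]; norm_num
    rw [ht, ← Real.sqrt_sq_eq_abs, mul_pow, e3]
    congr 2
    field_simp
    ring
  have hc := continuousOn_singularSolution k (0, σ) ⟨le_rfl, fun h => hσ (Prod.ext_iff.1 h).2⟩
  have hp : Tendsto (fun t : ℝ => ((1 + t ^ 2) ^ (-(3 / 2) : ℝ), t * (1 + t ^ 2) ^ (-(1 / 2) : ℝ)))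
      l (𝓝[puncturedHalfPlane] (0, σ)) := by
    refine tendsto_nhdsWithin_iff.2 ⟨hx.prodMk_nhds hz, Eventually.of_forall fun t => ?_⟩
    have : 0 < (1 + t ^ 2) ^ (-(3 / 2) : ℝ) := by positivity
    exact ⟨this.le, fun h => this.ne' (Prod.ext_iff.1 h).1⟩
  exact (hc.tendsto.comp hp).congr fun t => (angularProfile_eq_singularSolution k t).symm

lemma tendsto_angularProfile_atBot (k : ℤ) : Tendsto (angularProfile k) atBot (𝓝 1) := by
  have h : singularSolution k 0 (-1) = 1 := by
    simp [singularSolution, radialVar_zero_of_neg (by norm_num : (-1 : ℝ) < 0)]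
  have hsq : Tendsto (fun t : ℝ => t ^ 2) atBot atTop := by
    simpa [Function.comp_def] using
      (tendsto_pow_atTop (α := ℝ) two_ne_zero).comp tendsto_abs_atBot_atTop
  rw [← h]
  refine tendsto_angularProfile k (by norm_num) hsq ?_
  filter_upwards [eventually_le_atBot 0] with t ht
  rw [abs_of_nonpos (mul_nonpos_of_nonpos_of_nonneg ht (by positivity))]
  ring

lemma tendsto_angularProfile_atTop (k : ℤ) : Tendsto (angularProfile k) atTop (𝓝 0) := by
  have h : singularSolution k 0 1 = 0 := by simp [singularSolution]
  rw [← h]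
  refine tendsto_angularProfile k one_ne_zero (tendsto_pow_atTop two_ne_zero) ?_
  filter_upwards [eventually_ge_atTop 0] with t ht
  rw [abs_of_nonneg (by positivity), one_mul]

lemma exists_abs_le_of_tendsto {f : ℝ → ℝ} (hf : Continuous f) {l l' : ℝ}
    (hbot : Tendsto f atBot (𝓝 l)) (htop : Tendsto f atTop (𝓝 l')) :
    ∃ C : ℝ, ∀ t, |f t| ≤ C := by
  obtain ⟨A, hA⟩ := eventually_atBot.1 (hbot.abs.eventually_le_const (lt_add_one |l|))
  obtain ⟨B, hB⟩ := eventually_atTop.1 (htop.abs.eventually_le_const (lt_add_one |l'|))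
  obtain ⟨C, hC⟩ := isCompact_Icc.exists_bound_of_continuousOn (s := Icc A B) hf.continuousOn
  refine ⟨max (|l| + 1) (max (|l'| + 1) C), fun t => ?_⟩
  rcases le_total t A with h | h
  · exact (hA t h).trans (le_max_left _ _)
  rcases le_total B t with h' | h'
  · exact (hB t h').trans ((le_max_left _ _).trans (le_max_right _ _))
  · exact (hC t ⟨h, h'⟩).trans ((le_max_right _ _).trans (le_max_right _ _))

end

theorem mainTheorem9 (k : ℤ) :
    ContDiff ℝ ∞ (angularProfile k) ∧
    (∃ C : ℝ, ∀ t : ℝ, |angularProfile k t| ≤ C) ∧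
    Tendsto (angularProfile k) atBot (𝓝 1) ∧
    Tendsto (angularProfile k) atTop (𝓝 0) ∧
    IsHalfPlaneSolution (singularSolution k) :=
  ⟨contDiff_angularProfile k,
    exists_abs_le_of_tendsto (contDiff_angularProfile k).continuous
      (tendsto_angularProfile_atBot k) (tendsto_angularProfile_atTop k),
    tendsto_angularProfile_atBot k, tendsto_angularProfile_atTop k,
    isHalfPlaneSolution_singularSolution k⟩
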